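/- **Definitions.** A *virtual curve diagram* (vcd) with $n$ curves is a tuple $D=(P,<_P,<_C)$, where $P$ is a finite set of *points* and: * $(P,<_P)$ is a disjoint union of two chains, the chain $U$ of *upper points* and the chain $B$ of *base points*, with $|B|=n$; * $(P,<_C)$ is a disjoint union of $n$ chains, the *curves*; the least point of each curve is a base point, and the greatest point of each curve, its *terminal point*, is an upper point. If $b$ covers $a$ in $<_C$, then $(a,b)$ is an *arc*. On a curve $a_0<_C a_1<_C\dots<_C a_r$ the arcs $(a_{2k-1},a_{2k})$, $k\ge 1$, are the *over arcs*, and $(a_{r-1},a_r)$ is the *terminal arc*; * for no two over arcs $(x,y)$, $(z,w)$ does $\min\{x,y\}<_P\min\{z,w\}<_P\max\{x,y\}<_P\max\{z,w\}$ hold (min and max taken in $<_P$). Two points are *adjacent* if no point lies strictly between them in $<_P$. *Equivalence* $\sim$ of vcds is the equivalence relation generated by relabelling of points; the *$T$-move*, which deletes $b$ where $(a,b)$ is a terminal arc with $a,b$ adjacent; and the *$B$-move*, which deletes $b$ and $c$ where $(a,b),(b,c),(c,d)$ are consecutive arcs of a curve with $b,c$ adjacent (both orders are restricted to the remaining points,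 and the result has to be a vcd). A vcd is *simplified* if it has the least number of points in its equivalence class. Let $t_1<_P\dots<_P t_n$ be the terminal points of $D$. A *terminal over arc of type $(i,i+1)$* (respectively *$(i+1,i)$*) is a terminal arc $(a,b)$ that is an over arc, with $b=t_{i+1}$ and $t_i$ strictly between $a$ and $b$ in $<_P$ (respectively with $b=t_i$ and $t_{i+1}$ strictly between $a$ and $b$). A permutation $\pi\in S_n$ acts (on the left) on vcds up to equivalence as follows. Replace $D$ by an equivalent vcd $D'$ whose upper line can be cut into $n$ consecutive blocks, the $k$-th block containing $t_k$ and no other terminal point, such that both endpoints of every over arc lie in the same block. Move the $k$-th block to place $\pi(k)$ for all $k$, keeping the order of the points inside each block, the order of the base points, and the curves. The result represents $\pi\cdot D$. **Proposition.** Let $D$ be a simplified vcd with $n$ curves, $\pi\in S_n$, $1\le i,j\le n-1$. Suppose that $D$ has a terminal over arc of type $(i,i+1)$, and that a simplified representative of $\pi\cdot D$ has a terminal over arc of type $(j,j+1)$ or $(j+1,j)$. Then there is a permutation $\gamma\in S_n$ such that both terminal over arcs are left intact in $\gamma\cdot D$, i.e. $$\gamma(i+1)=\gamma(i)+1\qquad\text{and}\qquad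 \gamma\pi^{-1}(j+1)=\gamma\pi^{-1}(j)+1 .$$ -/

import Mathlib

/-- `(a, b)` is an arc of the order `ltC`: `b` covers `a`. -/
def IsArc {P : Type} (ltC : P → P → Prop) (a b : P) : Prop :=
  ltC a b ∧ ∀ c, ¬ (ltC a c ∧ ltC c b)

/-- The index `k` of a point `a = a_k` on its curve `a_0 <_C a_1 <_C ... <_C a_r`. -/
noncomputable def curveIndex {P : Type} (ltC : P → P → Prop) (a : P) : ℕ :=
  {b | ltC b a}.ncard

/-- Over arcs are the arcs `(a_{2k-1}, a_{2k})`, with `k ≥ 1`. -/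
def IsOverArc {P : Type} (ltC : P → P → Prop) (a b : P) : Prop :=
  IsArc ltC a b ∧ Odd (curveIndex ltC a)

/-- A virtual curve diagram `(P, <_P, <_C)` with `n` curves. The set `base` is the chain `B`
of base points; its complement is the chain `U` of upper points. -/
structure VCD (n : ℕ) where
  /-- the points -/
  P : Type
  finite_P : Finite P
  /-- the base points -/
  base : Set P
  /-- the order along the base line and along the upper line -/
  ltP : P → P → Prop
  /-- the order along the curves -/
  ltC : P → P → Prop
  ltP_irrefl : ∀ a, ¬ ltP a a
  ltP_trans : ∀ a b c, ltP a b → ltP b c → ltP a c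
  /-- two points are `<_P`-comparable exactly if both are upper points or both base points -/
  ltP_chains : ∀ a b, (a = b ∨ ltP a b ∨ ltP b a) ↔ (a ∈ base ↔ b ∈ base)
  ltC_irrefl : ∀ a, ¬ ltC a a
  ltC_trans : ∀ a b c, ltC a b → ltC b c → ltC a c
  /-- `<_C` is a disjoint union of chains: comparability is transitive -/
  ltC_chains : ∀ a b c, (a = b ∨ ltC a b ∨ ltC b a) → (b = c ∨ ltC b c ∨ ltC c b) →
    (a = c ∨ ltC a c ∨ ltC c a)
  card_base : base.ncard = n
  /-- every curve starts at a base point, and there are as many curves as base points -/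
  base_iff : ∀ a, a ∈ base ↔ ∀ b, ¬ ltC b a
  /-- every curve ends at an upper point -/
  terminal_upper : ∀ a, (∀ b, ¬ ltC a b) → a ∉ base
  /-- No two over arcs cross. Here `p, q` are the endpoints of one over arc and `r, s` those
  of another one, each pair written from left to right. -/
  over_noncrossing : ∀ p q r s,
    (IsOverArc ltC p q ∨ IsOverArc ltC q p) → (IsOverArc ltC r s ∨ IsOverArc ltC s r) →
    ¬ (ltP p r ∧ ltP r q ∧ ltP q s)

namespace VCD

variable {n : ℕ}

/-- The last point of a curve. -/
def IsTerminal (D : VCD n) (t : D.P) : Prop := ∀ b, ¬ D.ltC t b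

/-- `t` is the terminal point number `k` from the left, counted from `0`. -/
def IsTerminalAt (D : VCD n) (k : Fin n) (t : D.P) : Prop :=
  D.IsTerminal t ∧ {s | D.IsTerminal s ∧ D.ltP s t}.ncard = (k : ℕ)

/-- No point lies strictly between `a` and `b` in the order `<_P`. -/
def Adjacent (D : VCD n) (a b : D.P) : Prop :=
  ∀ c, ¬ (D.ltP a c ∧ D.ltP c b) ∧ ¬ (D.ltP b c ∧ D.ltP c a)

/-- Relabelling of the points. -/
def Relabelled (D E : VCD n) : Prop :=
  ∃ f : D.P ≃ E.P, (∀ x y, E.ltP (f x) (f y) ↔ D.ltP x y) ∧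
    ∀ x y, E.ltC (f x) (f y) ↔ D.ltC x y

/-- Up to relabelling, `E` is obtained from `D` by deleting the set `S` of points and
restricting both orders. -/
def DeletedTo (D : VCD n) (S : Set D.P) (E : VCD n) : Prop :=
  ∃ f : E.P → D.P, Function.Injective f ∧ Set.range f = Sᶜ ∧
    (∀ x y, D.ltP (f x) (f y) ↔ E.ltP x y) ∧ ∀ x y, D.ltC (f x) (f y) ↔ E.ltC x y

/-- The `T`-move: a terminal arc `(a, b)` with `a`, `b` adjacent is contracted to `a`.
(As `E` is a diagram, this cannot be the base arc.) -/
def TMove (D E : VCD n) : Prop :=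
  ∃ a b, IsArc D.ltC a b ∧ D.IsTerminal b ∧ D.Adjacent a b ∧ D.DeletedTo {b} E

/-- The `B`-move: in consecutive arcs `(a, b)`, `(b, c)`, `(c, d)` with `b`, `c` adjacent,
the points `b` and `c` are removed. -/
def BMove (D E : VCD n) : Prop :=
  ∃ a b c d, IsArc D.ltC a b ∧ IsArc D.ltC b c ∧ IsArc D.ltC c d ∧ D.Adjacent b c ∧
    D.DeletedTo {b, c} E

/-- The equivalence relation generated by relabellings, `T`-moves and `B`-moves. -/
def Equivalent : VCD n → VCD n → Prop :=
  Relation.EqvGen fun D E => D.Relabelled E ∨ D.TMove E ∨ D.BMove E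

/-- `D` has the least number of points in its equivalence class. -/
def Simplified (D : VCD n) : Prop :=
  ∀ E : VCD n, D.Equivalent E → Nat.card D.P ≤ Nat.card E.P

/-- The arc `(a, b)` encloses the upper point `c`. -/
def Encloses (D : VCD n) (a b c : D.P) : Prop :=
  c ∉ D.base ∧ ((D.ltP a c ∧ D.ltP c b) ∨ (D.ltP b c ∧ D.ltP c a))

/-- `D` has a terminal over arc of type `(k, l)`: it ends at the terminal point number `l`
and encloses the terminal point number `k` (to be used for neighbouring `k`, `l`). -/
def HasTerminalOverArc (D : VCD n) (k l : Fin n) : Prop :=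
  ∃ a b c, IsOverArc D.ltC a b ∧ D.IsTerminalAt l b ∧ D.IsTerminalAt k c ∧ D.Encloses a b c

/-- `E` is obtained from `D` by cutting the upper line into `n` consecutive blocks, one around
each terminal point and such that no over arc leaves its block, and by moving, for each `k`,
the block of the terminal point number `k` to place `π k`. The orders inside the blocks and on
the base line, and the curves, stay the same. -/
def BlockPermuted (π : Equiv.Perm (Fin n)) (D E : VCD n) : Prop :=
  ∃ (block : D.P → Fin n) (f : D.P ≃ E.P),
    (∀ a b, a ∉ D.base → b ∉ D.base → D.ltP a b → block a ≤ block b) ∧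
    (∀ k t, D.IsTerminalAt k t → block t = k) ∧
    (∀ a b, IsOverArc D.ltC a b → block a = block b) ∧
    (∀ a b, E.ltC (f a) (f b) ↔ D.ltC a b) ∧
    (∀ a b, a ∈ D.base → b ∈ D.base → (E.ltP (f a) (f b) ↔ D.ltP a b)) ∧
    (∀ a b, a ∉ D.base → b ∉ D.base →
      (E.ltP (f a) (f b) ↔
        π (block a) < π (block b) ∨ (block a = block b ∧ D.ltP a b)))

/-- `E` represents `π · D`. The action of `π` pushes the over arcs of `D` off the strands of the
virtual (permutation) braid: each over arc is first split, by inverse `B`-moves, between any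
two terminal points that it encloses, after which the pieces around a terminal point travel
with it. -/
def Represents (E : VCD n) (π : Equiv.Perm (Fin n)) (D : VCD n) : Prop :=
  ∃ D' E' : VCD n, D.Equivalent D' ∧ BlockPermuted π D' E' ∧ E'.Equivalent E

end VCD

/-- The permutation `γ` leaves intact a terminal over arc of type `(k, k+1)` or `(k+1, k)`. -/
def Intact {n : ℕ} (γ : Equiv.Perm (Fin n)) (k : ℕ) (hk : k + 1 < n) : Prop :=
  (γ ⟨k + 1, hk⟩ : ℕ) = (γ ⟨k, Nat.lt_of_succ_lt hk⟩ : ℕ) + 1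

/-! The proof replaces a diagram by a purely combinatorial invariant, its crossing system. A
crossing is an over arc together with a terminal point below it. It carries the number of that
terminal point, the number of the curve that crosses, and the direction. Crossings are ordered along
each curve, and in a stack over each terminal point. Two removals are allowed: cancelling two
crossings of one curve that are consecutive on the curve, neighbours in a stack and opposite in
direction, and unwinding the last crossing of a curve if it is innermost over that curve's own
endpoint.

Three facts make the invariant useful. Removals are confluent up to isomorphism
(`CrossingSystem.red_confluent`), so normal forms are unique (`CrossingSystem.Normal.iso`).
Relabellings, `T`-moves and `B`-moves of diagrams induce equivalences of crossing systems
(`VCD.Equivalent.eqv`), and permuting blocks merely renames the marked points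
(`VCD.BlockPermuted.iso`). A simplified diagram has a normal crossing system
(`VCD.Simplified.normal`), because a possible removal would reveal a `T`- or `B`-move. Hence the
crossing system of a simplified representative of `π · D` is that of `D` with renamed marked points
(`VCD.Represents.iso`).

A terminal over arc of either type leaves a trace (`UpEnd`, `DownEnd`) that mentions only the
crossing system, not the neighbourhood of the two terminal points on the line. So both given arcs
can be read off in the crossing system of `D`: one for the ordered pair `(i, i+1)`, the other for
`(p, q) = (π⁻¹ j, π⁻¹ (j+1))`. `UpEnd.compatible` shows that these ordered pairs are not reverses of
each other, and that they share a first entry exactly when they share a second. These are the only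
obstructions to making both pairs consecutive at once, which `exists_perm_consecutive` does. -/

theorem ncard_lt_of_rel {X : Type} [Finite X] {r : X → X → Prop} (irr : ∀ a, ¬ r a a)
    (tr : ∀ a b c, r a b → r b c → r a c) {x y : X} (h : r x y) :
    {z | r z x}.ncard < {z | r z y}.ncard :=
  Set.ncard_lt_ncard ⟨fun _ hz => tr _ _ _ hz h, fun hs => irr x (hs h)⟩

/-! ### Coordinates on a diagram: position on the line, index on the curve, number of the curve -/

namespace VCD

variable {n : ℕ} (D : VCD n)

attribute [instance] VCD.finite_P

/-- The number of points to the left of `x` on its line. -/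
noncomputable def pos (x : D.P) : ℕ := {z | D.ltP z x}.ncard

/-- The number of points before `x` on its curve. -/
noncomputable def idx (x : D.P) : ℕ := curveIndex D.ltC x

variable {D}

theorem pos_lt {x y : D.P} (h : D.ltP x y) : D.pos x < D.pos y :=
  ncard_lt_of_rel D.ltP_irrefl D.ltP_trans h

theorem idx_lt {x y : D.P} (h : D.ltC x y) : D.idx x < D.idx y :=
  ncard_lt_of_rel D.ltC_irrefl D.ltC_trans h

theorem ltP_tri {x y : D.P} (hx : x ∉ D.base) (hy : y ∉ D.base) :
    x = y ∨ D.ltP x y ∨ D.ltP y x :=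
  (D.ltP_chains x y).2 (by tauto)

theorem ltP_iff {x y : D.P} (hx : x ∉ D.base) (hy : y ∉ D.base) :
    D.ltP x y ↔ D.pos x < D.pos y := by
  refine ⟨pos_lt, fun h => ?_⟩
  rcases ltP_tri hx hy with rfl | h' | h'
  · omega
  · exact h'
  · have := pos_lt h'; omega

theorem eq_of_pos {x y : D.P} (hx : x ∉ D.base) (hy : y ∉ D.base) (h : D.pos x = D.pos y) :
    x = y := by
  rcases ltP_tri hx hy with h' | h' | h'
  · exact h'
  · have := pos_lt h'; omega
  · have := pos_lt h'; omega

theorem not_base_of_ltP {x y : D.P} (h : D.ltP x y) : x ∈ D.base ↔ y ∈ D.base :=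
  (D.ltP_chains x y).1 (Or.inr (Or.inl h))

theorem base_iff_idx {x : D.P} : x ∈ D.base ↔ D.idx x = 0 := by
  rw [D.base_iff, idx, curveIndex, Set.ncard_eq_zero, Set.eq_empty_iff_forall_notMem]
  rfl

theorem idx_of_isArc {x y : D.P} (h : IsArc D.ltC x y) : D.idx y = D.idx x + 1 := by
  have : {z | D.ltC z y} = insert x {z | D.ltC z x} := by
    ext z
    simp only [Set.mem_ofPred_eq, Set.mem_insert_iff]
    constructor
    · intro hz
      rcases D.ltC_chains z y x (Or.inr (Or.inl hz)) (Or.inr (Or.inr h.1)) with h' | h' | h'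
      · exact Or.inl h'
      · exact Or.inr h'
      · exact absurd ⟨h', hz⟩ (h.2 z)
    · rintro (rfl | hz)
      · exact h.1
      · exact D.ltC_trans _ _ _ hz h.1
  rw [idx, curveIndex, this, Set.ncard_insert_of_notMem (s := {z | D.ltC z x}) (D.ltC_irrefl x)]
  rfl

theorem exists_isArc_right {x : D.P} (h : ¬ D.IsTerminal x) : ∃ y, IsArc D.ltC x y := by
  simp only [IsTerminal, not_forall, not_not] at h
  obtain ⟨z, hz⟩ := h
  have : Nonempty {y // D.ltC x y} := ⟨⟨z, hz⟩⟩
  obtain ⟨y, hy⟩ := Finite.exists_min fun y : {y // D.ltC x y} => D.idx y.1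
  refine ⟨y, y.2, fun c hc => ?_⟩
  have h1 := hy ⟨c, hc.1⟩
  have h2 := idx_lt hc.2
  simp only at h1
  omega

theorem exists_isArc_left {y : D.P} (h : D.idx y ≠ 0) : ∃ x, IsArc D.ltC x y := by
  rw [Ne, ← base_iff_idx, D.base_iff] at h
  simp only [not_forall, not_not] at h
  obtain ⟨z, hz⟩ := h
  have : Nonempty {x // D.ltC x y} := ⟨⟨z, hz⟩⟩
  obtain ⟨x, hx⟩ := Finite.exists_max fun x : {x // D.ltC x y} => D.idx x.1
  refine ⟨x, x.2, fun c hc => ?_⟩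
  have h1 := hx ⟨c, hc.2⟩
  have h2 := idx_lt hc.1
  simp only at h1
  omega

theorem exists_terminal_above (x : D.P) : ∃ t, D.IsTerminal t ∧ (x = t ∨ D.ltC x t) := by
  have : Nonempty {y // x = y ∨ D.ltC x y} := ⟨⟨x, Or.inl rfl⟩⟩
  obtain ⟨y, hy⟩ := Finite.exists_max fun y : {y // x = y ∨ D.ltC x y} => D.idx y.1
  refine ⟨y, fun c hc => ?_, y.2⟩
  have hxc : x = c ∨ D.ltC x c := by
    rcases y.2 with h | h
    · right; rw [h]; exact hc
    · exact Or.inr (D.ltC_trans _ _ _ h hc)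
  have h1 := hy ⟨c, hxc⟩
  have h2 := idx_lt hc
  simp only at h1
  omega

theorem exists_base_below (x : D.P) : ∃ t, t ∈ D.base ∧ (t = x ∨ D.ltC t x) := by
  have : Nonempty {y // y = x ∨ D.ltC y x} := ⟨⟨x, Or.inl rfl⟩⟩
  obtain ⟨y, hy⟩ := Finite.exists_min fun y : {y // y = x ∨ D.ltC y x} => D.idx y.1
  refine ⟨y, (D.base_iff _).2 fun c hc => ?_, y.2⟩
  have hxc : c = x ∨ D.ltC c x := by
    rcases y.2 with h | h
    · right; rw [← h]; exact hc
    · exact Or.inr (D.ltC_trans _ _ _ hc h)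
  have h1 := hy ⟨c, hxc⟩
  have h2 := idx_lt hc
  simp only at h1
  omega

/-- The terminal point of the curve through `x`. -/
noncomputable def fin (x : D.P) : D.P := (exists_terminal_above x).choose

theorem fin_terminal (x : D.P) : D.IsTerminal (fin x) := (exists_terminal_above x).choose_spec.1

theorem fin_above (x : D.P) : x = fin x ∨ D.ltC x (fin x) :=
  (exists_terminal_above x).choose_spec.2

theorem fin_eq_iff {x y : D.P} : fin x = fin y ↔ (x = y ∨ D.ltC x y ∨ D.ltC y x) := by
  constructor
  · intro h
    have h1 := fin_above x
    have h2 := fin_above y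
    rw [h] at h1
    exact D.ltC_chains x (fin y) y (by tauto) (by rw [eq_comm]; tauto)
  · intro h
    have h1 := fin_above x
    have h2 := fin_above y
    have h3 := D.ltC_chains (fin x) x (fin y) (by rw [eq_comm]; tauto)
      (D.ltC_chains x y (fin y) h (by tauto))
    rcases h3 with h3 | h3 | h3
    · exact h3
    · exact absurd h3 (fin_terminal x _)
    · exact absurd h3 (fin_terminal y _)

theorem fin_of_terminal {t : D.P} (h : D.IsTerminal t) : fin t = t := by
  rcases fin_above t with h' | h'
  · exact h'.symm
  · exact absurd h' (h _)

theorem terminal_not_base {t : D.P} (h : D.IsTerminal t) : t ∉ D.base := D.terminal_upper t h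

theorem ncard_terminal : {t | D.IsTerminal t}.ncard = n := by
  refine Eq.trans ?_ D.card_base
  have : Set.BijOn (fin (D := D)) D.base {t | D.IsTerminal t} := by
    refine ⟨fun x _ => fin_terminal x, fun x hx y hy h => ?_, fun t ht => ?_⟩
    · rcases fin_eq_iff.1 h with h | h | h
      · exact h
      · exact absurd h ((D.base_iff y).1 hy x)
      · exact absurd h ((D.base_iff x).1 hx y)
    · obtain ⟨b, hb, h⟩ := exists_base_below t
      refine ⟨b, hb, ?_⟩
      rw [← fin_of_terminal (D := D) ht, fin_eq_iff]
      tauto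
  exact this.ncard_eq.symm

theorem ncard_terminal_left_lt {t : D.P} (h : D.IsTerminal t) :
    {s | D.IsTerminal s ∧ D.ltP s t}.ncard < n := by
  refine lt_of_lt_of_eq ?_ (ncard_terminal (D := D))
  exact Set.ncard_lt_ncard ⟨fun s hs => hs.1, fun hs => D.ltP_irrefl t (hs h).2⟩

/-- The number of the curve through `x`: the place of its terminal point among all of them. -/
noncomputable def crv (x : D.P) : Fin n := ⟨_, ncard_terminal_left_lt (fin_terminal x)⟩

theorem crv_fin (x : D.P) : crv (fin x) = crv x := by
  simp only [crv, fin_of_terminal (fin_terminal x)]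

theorem crv_val {t : D.P} (h : D.IsTerminal t) :
    (crv t : ℕ) = {s | D.IsTerminal s ∧ D.ltP s t}.ncard := by
  simp only [crv, fin_of_terminal h]

theorem isTerminalAt_iff {k : Fin n} {t : D.P} :
    D.IsTerminalAt k t ↔ D.IsTerminal t ∧ crv t = k := by
  constructor
  · rintro ⟨h, h'⟩
    refine ⟨h, Fin.ext ?_⟩
    rw [crv_val h, h']
  · rintro ⟨h, rfl⟩
    exact ⟨h, (crv_val h).symm⟩

theorem crv_lt {s t : D.P} (hs : D.IsTerminal s) (ht : D.IsTerminal t) (h : D.ltP s t) :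
    crv s < crv t := by
  rw [Fin.lt_def, crv_val hs, crv_val ht]
  exact Set.ncard_lt_ncard ⟨fun z hz => ⟨hz.1, D.ltP_trans _ _ _ hz.2 h⟩,
    fun hh => D.ltP_irrefl s (hh ⟨hs, h⟩).2⟩

theorem crv_lt_iff {s t : D.P} (hs : D.IsTerminal s) (ht : D.IsTerminal t) :
    crv s < crv t ↔ D.pos s < D.pos t := by
  rw [← ltP_iff (terminal_not_base hs) (terminal_not_base ht)]
  refine ⟨fun h => ?_, crv_lt hs ht⟩
  rcases ltP_tri (terminal_not_base hs) (terminal_not_base ht) with rfl | h' | h'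
  · exact absurd h (lt_irrefl _)
  · exact h'
  · exact absurd (crv_lt ht hs h') h.asymm

theorem terminal_ext {s t : D.P} (hs : D.IsTerminal s) (ht : D.IsTerminal t)
    (h : crv s = crv t) : s = t := by
  rcases ltP_tri (terminal_not_base hs) (terminal_not_base ht) with h' | h' | h'
  · exact h'
  · exact absurd h (crv_lt hs ht h').ne
  · exact absurd h (crv_lt ht hs h').ne'

theorem exists_terminalAt (k : Fin n) : ∃ t : D.P, D.IsTerminal t ∧ crv t = k := by
  let f : {t // D.IsTerminal t} → Fin n := fun t => crv t.1
  have hinj : Function.Injective f := fun s t h => Subtype.ext (terminal_ext s.2 t.2 h)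
  have hcard : Nat.card {t // D.IsTerminal t} = Nat.card (Fin n) := by
    rw [Nat.card_fin]; exact ncard_terminal (D := D)
  obtain ⟨t, ht⟩ := ((Nat.bijective_iff_injective_and_card f).2 ⟨hinj, hcard⟩).2 k
  exact ⟨t.1, t.2, ht⟩

theorem crv_eq_iff {x y : D.P} : crv x = crv y ↔ (x = y ∨ D.ltC x y ∨ D.ltC y x) := by
  rw [← fin_eq_iff, ← crv_fin x, ← crv_fin y]
  exact ⟨terminal_ext (fin_terminal x) (fin_terminal y), fun h => by rw [h]⟩

/-- Curve number and index are coordinates for `<_C`, as `pos` is for the upper line. They turn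
order arguments into linear arithmetic. -/
theorem ltC_iff {x y : D.P} : D.ltC x y ↔ crv x = crv y ∧ D.idx x < D.idx y := by
  constructor
  · intro h
    exact ⟨crv_eq_iff.2 (by tauto), idx_lt h⟩
  · rintro ⟨h1, h2⟩
    rcases crv_eq_iff.1 h1 with rfl | h | h
    · omega
    · exact h
    · have := idx_lt h; omega

theorem eq_of_idx {x y : D.P} (h : crv x = crv y) (h' : D.idx x = D.idx y) : x = y := by
  rcases crv_eq_iff.1 h with h | h | h
  · exact h
  · have := idx_lt h; omega
  · have := idx_lt h; omega

theorem isArc_iff {x y : D.P} : IsArc D.ltC x y ↔ crv x = crv y ∧ D.idx y = D.idx x + 1 := by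
  constructor
  · intro h
    exact ⟨(ltC_iff.1 h.1).1, idx_of_isArc h⟩
  · rintro ⟨h1, h2⟩
    refine ⟨ltC_iff.2 ⟨h1, by omega⟩, fun c hc => ?_⟩
    have := idx_lt hc.1
    have := idx_lt hc.2
    omega

theorem isOverArc_iff {x y : D.P} : IsOverArc D.ltC x y ↔
    crv x = crv y ∧ D.idx y = D.idx x + 1 ∧ D.idx x % 2 = 1 := by
  rw [IsOverArc, isArc_iff, ← Nat.odd_iff, and_assoc]
  rfl

theorem terminal_idx {t x : D.P} (h : D.IsTerminal t) (hx : crv x = crv t) :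
    D.idx x ≤ D.idx t := by
  by_contra hlt
  exact h x (ltC_iff.2 ⟨hx.symm, by omega⟩)

theorem exists_succ {x : D.P} (h : ¬ D.IsTerminal x) :
    ∃ y : D.P, crv x = crv y ∧ D.idx y = D.idx x + 1 := by
  obtain ⟨y, hy⟩ := exists_isArc_right h
  exact ⟨y, isArc_iff.1 hy⟩

theorem exists_pred {x : D.P} (h : D.idx x ≠ 0) :
    ∃ y : D.P, crv y = crv x ∧ D.idx x = D.idx y + 1 := by
  obtain ⟨y, hy⟩ := exists_isArc_left h
  exact ⟨y, isArc_iff.1 hy⟩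

/-- The numbering of the curves is the only one that increases along the terminal points. -/
theorem crv_unique (g : D.P → Fin n) (hC : ∀ x y, D.ltC x y → g x = g y)
    (hmono : ∀ s t, D.IsTerminal s → D.IsTerminal t → D.ltP s t → g s < g t) (x : D.P) :
    g x = crv x := by
  choose t ht htk using exists_terminalAt (D := D)
  have hm : StrictMono fun k => g (t k) := by
    intro k l hkl
    refine hmono _ _ (ht k) (ht l) ?_
    rw [ltP_iff (terminal_not_base (ht k)) (terminal_not_base (ht l)),
      ← crv_lt_iff (ht k) (ht l), htk, htk]
    exact hkl
  -- A strictly monotone self-map of `Fin n` is the identity.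
  have hid : ∀ k, g (t k) = k := fun k => le_antisymm hm.apply_le hm.le_apply
  have h1 : g x = g (fin x) := by
    rcases fin_above x with h | h
    · rw [← h]
    · exact hC _ _ h
  have h2 : fin x = t (crv x) := terminal_ext (fin_terminal x) (ht _) (by rw [htk, crv_fin])
  rw [h1, h2, hid]

end VCD

/-! ### Crossing systems and uniqueness of their normal forms -/

/-- A crossing system: abstract crossings of `n` curves over `n` marked points. Each crossing `x`
belongs to the stack of the marked point `lev x` and to the curve that ends at the marked point
`col x`, and it has a direction. The crossings of a curve, and those of a stack, are linearly
ordered. -/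
structure CrossingSystem (n : ℕ) where
  /-- the crossings -/
  X : Type
  finite_X : Finite X
  /-- the marked point that is crossed -/
  lev : X → Fin n
  /-- the endpoint of the crossing curve -/
  col : X → Fin n
  /-- the curve crosses from left to right -/
  up : X → Prop
  /-- the order along the curves -/
  cur : X → X → Prop
  /-- the order in the stacks, from the innermost crossing outwards -/
  stk : X → X → Prop
  cur_irrefl : ∀ x, ¬ cur x x
  cur_trans : ∀ x y z, cur x y → cur y z → cur x z
  cur_chains : ∀ x y, (x = y ∨ cur x y ∨ cur y x) ↔ col x = col y
  stk_irrefl : ∀ x, ¬ stk x x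
  stk_trans : ∀ x y z, stk x y → stk y z → stk x z
  stk_chains : ∀ x y, (x = y ∨ stk x y ∨ stk y x) ↔ lev x = lev y

namespace CrossingSystem

variable {n : ℕ}

attribute [instance] CrossingSystem.finite_X

/-- The number of crossings before `x` on its curve. -/
noncomputable def cr (A : CrossingSystem n) (x : A.X) : ℕ := {z | A.cur z x}.ncard

/-- The number of crossings inside `x` in its stack. -/
noncomputable def sr (A : CrossingSystem n) (x : A.X) : ℕ := {z | A.stk z x}.ncard

section

variable {A : CrossingSystem n} {x y : A.X}

theorem cur_iff : A.cur x y ↔ A.col x = A.col y ∧ A.cr x < A.cr y := by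
  have key : ∀ {x y}, A.cur x y → A.cr x < A.cr y :=
    fun h => ncard_lt_of_rel A.cur_irrefl A.cur_trans h
  constructor
  · exact fun h => ⟨(A.cur_chains x y).1 (by tauto), key h⟩
  · rintro ⟨h1, h2⟩
    rcases (A.cur_chains x y).2 h1 with rfl | h | h
    · omega
    · exact h
    · have := key h; omega

theorem stk_iff : A.stk x y ↔ A.lev x = A.lev y ∧ A.sr x < A.sr y := by
  have key : ∀ {x y}, A.stk x y → A.sr x < A.sr y :=
    fun h => ncard_lt_of_rel A.stk_irrefl A.stk_trans h
  constructor
  · exact fun h => ⟨(A.stk_chains x y).1 (by tauto), key h⟩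
  · rintro ⟨h1, h2⟩
    rcases (A.stk_chains x y).2 h1 with rfl | h | h
    · omega
    · exact h
    · have := key h; omega

theorem eq_of_cr (h : A.col x = A.col y) (h' : A.cr x = A.cr y) : x = y := by
  rcases (A.cur_chains x y).2 h with h | h | h
  · exact h
  · have := (cur_iff.1 h).2; omega
  · have := (cur_iff.1 h).2; omega

theorem eq_of_sr (h : A.lev x = A.lev y) (h' : A.sr x = A.sr y) : x = y := by
  rcases (A.stk_chains x y).2 h with h | h | h
  · exact h
  · have := (stk_iff.1 h).2; omega
  · have := (stk_iff.1 h).2; omega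

end

/-- Consecutive crossings of a curve, in opposite directions and next to each other in a stack. -/
structure Cancels (A : CrossingSystem n) (x y : A.X) : Prop where
  col : A.col x = A.col y
  lev : A.lev x = A.lev y
  up : ¬ (A.up x ↔ A.up y)
  cur : ∀ z, ¬ (A.cur x z ∧ A.cur z y) ∧ ¬ (A.cur y z ∧ A.cur z x)
  stk : ∀ z, ¬ (A.stk x z ∧ A.stk z y) ∧ ¬ (A.stk y z ∧ A.stk z x)

/-- The last crossing of a curve, being the innermost one over the endpoint of that curve. -/
structure Unwinds (A : CrossingSystem n) (x : A.X) : Prop where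
  col : A.col x = A.lev x
  cur : ∀ z, ¬ A.cur x z
  stk : ∀ z, ¬ A.stk z x

/-- The set `S` consists of two crossings that cancel or of one that unwinds. -/
def Redex (A : CrossingSystem n) (S : Set A.X) : Prop :=
  (∃ x y, A.Cancels x y ∧ S = {x, y}) ∨ ∃ x, A.Unwinds x ∧ S = {x}

/-- No crossings can be removed. -/
def Normal (A : CrossingSystem n) : Prop := ∀ S, ¬ A.Redex S

/-- Embeddings of crossing systems. -/
structure Emb (B A : CrossingSystem n) where
  /-- the underlying map -/
  f : B.X → A.X
  inj : Function.Injective f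
  lev : ∀ x, A.lev (f x) = B.lev x
  col : ∀ x, A.col (f x) = B.col x
  up : ∀ x, A.up (f x) ↔ B.up x
  cur : ∀ x y, A.cur (f x) (f y) ↔ B.cur x y
  stk : ∀ x y, A.stk (f x) (f y) ↔ B.stk x y

/-- Isomorphic crossing systems. -/
def Iso (A B : CrossingSystem n) : Prop := ∃ f : Emb B A, Function.Surjective f.f

/-- One removal. -/
def Step (A B : CrossingSystem n) : Prop := ∃ (f : Emb B A) (S : _), A.Redex S ∧ Set.range f.f = Sᶜ

/-- One removal or an isomorphism. -/
def Red (A B : CrossingSystem n) : Prop := Iso A B ∨ Step A B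

/-- The equivalence relation generated by removals and isomorphisms. -/
def Eqv : CrossingSystem n → CrossingSystem n → Prop := Relation.EqvGen Red

variable {A B C : CrossingSystem n}

theorem Cancels.ne {x y : A.X} (h : A.Cancels x y) : x ≠ y := by
  rintro rfl; exact h.up Iff.rfl

theorem Cancels.symm {x y : A.X} (h : A.Cancels x y) : A.Cancels y x :=
  ⟨h.col.symm, h.lev.symm, fun h' => h.up h'.symm, fun z => (h.cur z).symm,
    fun z => (h.stk z).symm⟩

/-- The identity embedding. -/
def Emb.refl (A : CrossingSystem n) : Emb A A where
  f := id
  inj := Function.injective_id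
  lev _ := rfl
  col _ := rfl
  up _ := Iff.rfl
  cur _ _ := Iff.rfl
  stk _ _ := Iff.rfl

/-- The composition of embeddings. -/
def Emb.comp (f : Emb B A) (g : Emb C B) : Emb C A where
  f := f.f ∘ g.f
  inj := f.inj.comp g.inj
  lev x := (f.lev _).trans (g.lev x)
  col x := (f.col _).trans (g.col x)
  up x := (f.up _).trans (g.up x)
  cur x y := (f.cur _ _).trans (g.cur x y)
  stk x y := (f.stk _ _).trans (g.stk x y)

theorem Emb.exists_lift (f : Emb B A) (g : Emb C A) (h : Set.range f.f ⊆ Set.range g.f) :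
    ∃ k : Emb B C, ∀ x, g.f (k.f x) = f.f x := by
  choose k hk using fun x => h ⟨x, rfl⟩
  refine ⟨⟨k, fun x y hxy => f.inj ?_, fun x => ?_, fun x => ?_, fun x => ?_, fun x y => ?_,
    fun x y => ?_⟩, hk⟩
  · rw [← hk, hxy, hk]
  · rw [← g.lev, hk, f.lev]
  · rw [← g.col, hk, f.col]
  · rw [← g.up, hk, f.up]
  · rw [← g.cur, hk, hk, f.cur]
  · rw [← g.stk, hk, hk, f.stk]

/-- The conditions for a removal only forbid other crossings in certain places, so they survive when
crossings outside `S` disappear. This is why disjoint removals commute. -/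
theorem Emb.redex (f : Emb B A) {S : Set A.X} (hS : S ⊆ Set.range f.f) (h : A.Redex S) :
    B.Redex (f.f ⁻¹' S) := by
  rcases h with ⟨x, y, h, rfl⟩ | ⟨x, h, rfl⟩
  · obtain ⟨x, rfl⟩ := hS (Set.mem_insert _ _)
    obtain ⟨y, rfl⟩ := hS (Set.mem_insert_of_mem _ rfl)
    refine Or.inl ⟨x, y, ⟨?_, ?_, ?_, fun z => ?_, fun z => ?_⟩, ?_⟩
    · rw [← f.col, ← f.col, h.col]
    · rw [← f.lev, ← f.lev, h.lev]
    · rw [← f.up, ← f.up]; exact h.up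
    · simp only [← f.cur]; exact h.cur _
    · simp only [← f.stk]; exact h.stk _
    · ext z
      simp [f.inj.eq_iff]
  · obtain ⟨x, rfl⟩ := hS rfl
    refine Or.inr ⟨x, ⟨?_, fun z => ?_, fun z => ?_⟩, ?_⟩
    · rw [← f.col, ← f.lev, h.col]
    · rw [← f.cur]; exact h.cur _
    · rw [← f.stk]; exact h.stk _
    · ext z
      simp [f.inj.eq_iff]

theorem Iso.symm (h : Iso A B) : Iso B A := by
  obtain ⟨f, hf⟩ := h
  obtain ⟨k, hk⟩ := (Emb.refl A).exists_lift f (by rw [hf.range_eq]; exact Set.subset_univ _)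
  exact ⟨k, fun x => ⟨f.f x, f.inj (hk _)⟩⟩

theorem Iso.trans (h : Iso A B) (h' : Iso B C) : Iso A C := by
  obtain ⟨f, hf⟩ := h
  obtain ⟨g, hg⟩ := h'
  exact ⟨f.comp g, hf.comp hg⟩

theorem Iso.refl (A : CrossingSystem n) : Iso A A := ⟨Emb.refl A, Function.surjective_id⟩

theorem Iso.normal (h : Iso A B) (hA : A.Normal) : B.Normal := by
  obtain ⟨f, hf⟩ := h.symm
  exact fun S hS => hA _ (f.redex (by rw [hf.range_eq]; exact Set.subset_univ _) hS)

theorem Iso.step (h : Iso A B) (hA : Step A C) : Step B C := by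
  obtain ⟨f, hf⟩ := h
  obtain ⟨g, S, hS, hg⟩ := hA
  obtain ⟨k, hk⟩ := g.exists_lift f (by rw [hf.range_eq]; exact Set.subset_univ _)
  refine ⟨k, _, f.redex (by rw [hf.range_eq]; exact Set.subset_univ _) hS, ?_⟩
  ext x
  rw [Set.mem_compl_iff, Set.mem_preimage, ← Set.mem_compl_iff, ← hg]
  constructor
  · rintro ⟨y, rfl⟩
    exact ⟨y, (hk y).symm⟩
  · rintro ⟨y, hy⟩
    exact ⟨y, f.inj (by rw [hk, hy])⟩

/-- The crossing system consisting of the crossings in `K`. -/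
def restrict (A : CrossingSystem n) (K : Set A.X) : CrossingSystem n where
  X := K
  finite_X := inferInstance
  lev x := A.lev x
  col x := A.col x
  up x := A.up x
  cur x y := A.cur x y
  stk x y := A.stk x y
  cur_irrefl x := A.cur_irrefl x
  cur_trans x y z := A.cur_trans x y z
  cur_chains x y := by rw [← A.cur_chains, Subtype.ext_iff]
  stk_irrefl x := A.stk_irrefl x
  stk_trans x y z := A.stk_trans x y z
  stk_chains x y := by rw [← A.stk_chains, Subtype.ext_iff]

/-- The inclusion of a part of a crossing system. -/
def incl (A : CrossingSystem n) (K : Set A.X) : Emb (A.restrict K) A where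
  f := Subtype.val
  inj := Subtype.val_injective
  lev _ := rfl
  col _ := rfl
  up _ := Iff.rfl
  cur _ _ := Iff.rfl
  stk _ _ := Iff.rfl

theorem range_incl (A : CrossingSystem n) (K : Set A.X) : Set.range (A.incl K).f = K :=
  Subtype.range_val

theorem step_of_emb (f : Emb B A) (g : Emb C A) {S : Set A.X} (h : A.Redex S)
    (hS : S ⊆ Set.range f.f) (hg : Set.range g.f = Set.range f.f \ S) : Step B C := by
  obtain ⟨k, hk⟩ := g.exists_lift f (by rw [hg]; exact Set.sdiff_subset)
  refine ⟨k, _, f.redex hS h, ?_⟩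
  ext x
  have : f.f x ∈ Set.range g.f ↔ f.f x ∉ S := by rw [hg]; simp
  rw [Set.mem_compl_iff, Set.mem_preimage, ← this]
  constructor
  · rintro ⟨y, rfl⟩
    exact ⟨y, (hk y).symm⟩
  · rintro ⟨y, hy⟩
    exact ⟨y, f.inj (by rw [hk, hy])⟩

theorem iso_of_emb (f : Emb B A) (g : Emb C A) (h : Set.range f.f = Set.range g.f) :
    Iso B C := by
  obtain ⟨k, hk⟩ := g.exists_lift f h.ge
  refine ⟨k, fun x => ?_⟩
  obtain ⟨y, hy⟩ := h.le ⟨x, rfl⟩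
  exact ⟨y, f.inj (by rw [hk, hy])⟩

/-- If `x` cancels with `y` and with `z`, both removals have the same result. -/
theorem iso_of_overlap (f : Emb B A) (g : Emb C A) {x y z : A.X} (h : A.Cancels x y)
    (h' : A.Cancels y z) (hxz : x ≠ z) (hf : Set.range f.f = {x, y}ᶜ)
    (hg : Set.range g.f = {y, z}ᶜ) : Iso B C := by
  classical
  -- Both `x` and `z` are next to `y`, on the curve and in the stack, so no other crossing can tell
  -- them apart.
  have hc : ∀ w, w ≠ x → w ≠ y → w ≠ z → (A.cur w x ↔ A.cur w z) ∧ (A.cur x w ↔ A.cur z w) ∧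
      (A.stk w x ↔ A.stk w z) ∧ (A.stk x w ↔ A.stk z w) := by
    intro w hx hy hz
    have h1 := h.cur w
    have h2 := h'.cur w
    have h3 := h.stk w
    have h4 := h'.stk w
    have e1 := h.col
    have e2 := h'.col
    have e3 := h.lev
    have e4 := h'.lev
    simp only [cur_iff, stk_iff, e1, e2, e3, e4] at h1 h2 h3 h4 ⊢
    have n1 := fun e => mt (eq_of_cr (x := w) (y := x) e) hx
    have n2 := fun e => mt (eq_of_cr (x := w) (y := y) e) hy
    have n3 := fun e => mt (eq_of_cr (x := w) (y := z) e) hz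
    have m1 := fun e => mt (eq_of_sr (x := w) (y := x) e) hx
    have m2 := fun e => mt (eq_of_sr (x := w) (y := y) e) hy
    have m3 := fun e => mt (eq_of_sr (x := w) (y := z) e) hz
    rw [e1, e2] at n1
    rw [e2] at n2
    rw [e3, e4] at m1
    rw [e4] at m2
    refine ⟨?_, ?_, ?_, ?_⟩
    · exact and_congr_right fun hw => by
        have := n1 hw; have := n2 hw; have := n3 hw
        simp only [hw, true_and] at h1 h2; omega
    · refine and_congr_right fun hw => ?_
      have := n1 hw.symm; have := n2 hw.symm; have := n3 hw.symm
      simp only [hw, true_and] at h1 h2; omega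
    · refine and_congr_right fun hw => ?_
      have := m1 hw; have := m2 hw; have := m3 hw
      simp only [hw, true_and] at h3 h4; omega
    · refine and_congr_right fun hw => ?_
      have := m1 hw.symm; have := m2 hw.symm; have := m3 hw.symm
      simp only [hw, true_and] at h3 h4; omega
  have hup : A.up x ↔ A.up z := by
    have := h.up
    have := h'.up
    tauto
  have hB : ∀ b, f.f b ≠ x ∧ f.f b ≠ y := fun b => by
    have : f.f b ∈ ({x, y}ᶜ : Set A.X) := hf ▸ ⟨b, rfl⟩
    simpa [not_or] using this
  -- Putting `x` in the place of `z` carries the complement of `{x, y}` to that of `{y, z}`.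
  let s : A.X → A.X := fun w => if w = z then x else w
  have hs : ∀ w, w ≠ x → w ≠ y → (w = z ∧ s w = x) ∨ (w ≠ z ∧ s w = w) := by
    intro w _ _
    by_cases hw : w = z
    · exact Or.inl ⟨hw, if_pos hw⟩
    · exact Or.inr ⟨hw, if_neg hw⟩
  let k : Emb B A :=
    { f := fun b => s (f.f b)
      inj := by
        intro b c hbc
        refine f.inj ?_
        rcases hs _ (hB b).1 (hB b).2 with ⟨h1, h2⟩ | ⟨h1, h2⟩ <;>
        rcases hs _ (hB c).1 (hB c).2 with ⟨h3, h4⟩ | ⟨h3, h4⟩ <;>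
        simp only [h2, h4] at hbc
        · rw [h1, h3]
        · exact absurd hbc.symm (hB c).1
        · exact absurd hbc (hB b).1
        · exact hbc
      lev := by
        intro b
        rw [← f.lev]
        rcases hs _ (hB b).1 (hB b).2 with ⟨h1, h2⟩ | ⟨h1, h2⟩ <;> rw [h2]
        rw [h1, h.lev, h'.lev]
      col := by
        intro b
        rw [← f.col]
        rcases hs _ (hB b).1 (hB b).2 with ⟨h1, h2⟩ | ⟨h1, h2⟩ <;> rw [h2]
        rw [h1, h.col, h'.col]
      up := by
        intro b
        rw [← f.up]
        rcases hs _ (hB b).1 (hB b).2 with ⟨h1, h2⟩ | ⟨h1, h2⟩ <;> rw [h2]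
        rw [h1, hup]
      cur := by
        intro b c
        rw [← f.cur]
        rcases hs _ (hB b).1 (hB b).2 with ⟨h1, h2⟩ | ⟨h1, h2⟩ <;>
        rcases hs _ (hB c).1 (hB c).2 with ⟨h3, h4⟩ | ⟨h3, h4⟩ <;> rw [h2, h4]
        · simp only [h1, h3, A.cur_irrefl]
        · rw [h1, (hc _ (hB c).1 (hB c).2 h3).2.1]
        · rw [h3, (hc _ (hB b).1 (hB b).2 h1).1]
      stk := by
        intro b c
        rw [← f.stk]
        rcases hs _ (hB b).1 (hB b).2 with ⟨h1, h2⟩ | ⟨h1, h2⟩ <;>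
        rcases hs _ (hB c).1 (hB c).2 with ⟨h3, h4⟩ | ⟨h3, h4⟩ <;> rw [h2, h4]
        · simp only [h1, h3, A.stk_irrefl]
        · rw [h1, (hc _ (hB c).1 (hB c).2 h3).2.2.2]
        · rw [h3, (hc _ (hB b).1 (hB b).2 h1).2.2.1] }
  refine iso_of_emb k g ?_
  rw [hg]
  ext w
  simp only [Set.mem_compl_iff, Set.mem_insert_iff, Set.mem_singleton_iff, not_or]
  constructor
  · rintro ⟨b, rfl⟩
    show s (f.f b) ≠ y ∧ s (f.f b) ≠ z
    rcases hs _ (hB b).1 (hB b).2 with ⟨h1, h2⟩ | ⟨h1, h2⟩ <;> rw [h2]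
    · exact ⟨h.ne, hxz⟩
    · exact ⟨(hB b).2, h1⟩
  · rintro ⟨h1, h2⟩
    by_cases hw : w = x
    · have : z ∈ Set.range f.f := by rw [hf]; simp [hxz.symm, h'.ne.symm]
      obtain ⟨b, hb⟩ := this
      exact ⟨b, by show s (f.f b) = w; rw [hb, hw]; exact if_pos rfl⟩
    · have : w ∈ Set.range f.f := by rw [hf]; simp [hw, h1]
      obtain ⟨b, hb⟩ := this
      exact ⟨b, by show s (f.f b) = w; rw [hb]; exact if_neg h2⟩

/-- After `y` has unwound, a crossing that could have been cancelled with `y` unwinds, too. -/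
theorem step_of_cancels_unwinds (f : Emb B A) (g : Emb C A) {x y : A.X} (h : A.Cancels x y)
    (h' : A.Unwinds y) (hf : Set.range f.f = {x, y}ᶜ) (hg : Set.range g.f = {y}ᶜ) :
    Step C B := by
  obtain ⟨k, hk⟩ := f.exists_lift g (by rw [hf, hg]; intro w; simp)
  have hx : x ∈ Set.range g.f := by rw [hg]; simpa using h.ne
  obtain ⟨c, rfl⟩ := hx
  have hy : ∀ d, g.f d ≠ y := fun d => by
    have : g.f d ∈ ({y}ᶜ : Set A.X) := hg ▸ ⟨d, rfl⟩
    simpa using this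
  refine ⟨k, {c}, Or.inr ⟨c, ⟨?_, fun z hz => ?_, fun z hz => ?_⟩, rfl⟩, ?_⟩
  · rw [← g.lev, ← g.col, h.lev, h.col, h'.col]
  · rw [← g.cur] at hz
    rcases (A.cur_chains (g.f z) y).2
      (by rw [← h.col]; exact ((A.cur_chains _ _).1 (Or.inr (Or.inl hz))).symm) with e | e | e
    · exact hy _ e
    · exact (h.cur _).1 ⟨hz, e⟩
    · exact h'.cur _ e
  · rw [← g.stk] at hz
    rcases (A.stk_chains (g.f z) y).2
      (by rw [← h.lev]; exact (A.stk_chains _ _).1 (Or.inr (Or.inl hz))) with e | e | e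
    · exact hy _ e
    · exact h'.stk _ e
    · exact (h.stk _).2 ⟨e, hz⟩
  · ext w
    have : g.f w ∈ Set.range f.f ↔ w ∉ ({c} : Set C.X) := by
      rw [hf]
      simp [hy w, g.inj.eq_iff]
    rw [Set.mem_compl_iff, ← this]
    constructor
    · rintro ⟨b, rfl⟩
      exact ⟨b, (hk b).symm⟩
    · rintro ⟨b, hb⟩
      exact ⟨b, g.inj (by rw [hk, hb])⟩

/-- Disjoint removals commute. Overlapping ones share a crossing `y`: two cancellations of `y` have
isomorphic results, and if `y` cancels with `x` but also unwinds, then unwinding `y` lets `x` unwind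
next. Since isomorphisms count as steps, one side closes in at most one step. This is the form from
which Church–Rosser follows with no appeal to termination. -/
theorem red_confluent (h : Red A B) (h' : Red A C) :
    ∃ D, Relation.ReflGen Red B D ∧ Relation.ReflTransGen Red C D := by
  rcases h with h | h
  · rcases h' with h' | h'
    · exact ⟨C, .single (Or.inl (h.symm.trans h')), .refl⟩
    · exact ⟨C, .single (Or.inr (h.step h')), .refl⟩
  · rcases h' with h' | h'
    · exact ⟨B, .refl, .single (Or.inr (h'.step h))⟩
    · obtain ⟨f, S, hS, hf⟩ := h
      obtain ⟨g, T, hT, hg⟩ := h'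
      by_cases hST : S = T
      · exact ⟨C, .single (Or.inl (iso_of_emb f g (by rw [hf, hg, hST]))), .refl⟩
      by_cases hd : Disjoint S T
      · refine ⟨A.restrict (S ∪ T)ᶜ, .single (Or.inr ?_), .single (Or.inr ?_)⟩
        · refine step_of_emb f (A.incl _) hT ?_ ?_
          · rw [hf]; exact hd.symm.subset_compl_right
          · rw [range_incl, hf, Set.compl_union, Set.sdiff_eq]
        · refine step_of_emb g (A.incl _) hS ?_ ?_
          · rw [hg]; exact hd.subset_compl_right
          · rw [range_incl, hg, Set.compl_union, Set.sdiff_eq, Set.inter_comm]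
      rw [Set.not_disjoint_iff] at hd
      obtain ⟨y, hyS, hyT⟩ := hd
      have key : ∀ S, A.Redex S → y ∈ S → (∃ x, A.Cancels x y ∧ S = {x, y}) ∨
          (A.Unwinds y ∧ S = {y}) := by
        rintro S (⟨a, b, h, rfl⟩ | ⟨a, h, rfl⟩) hy
        · rcases hy with rfl | rfl
          · exact Or.inl ⟨b, h.symm, Set.pair_comm _ _⟩
          · exact Or.inl ⟨a, h, rfl⟩
        · obtain rfl := hy
          exact Or.inr ⟨h, rfl⟩
      rcases key S hS hyS with ⟨x, hx, rfl⟩ | ⟨hx, rfl⟩ <;>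
      rcases key T hT hyT with ⟨z, hz, rfl⟩ | ⟨hz, rfl⟩
      · refine ⟨C, .single (Or.inl (iso_of_overlap f g hx hz.symm ?_ hf ?_)), .refl⟩
        · rintro rfl; exact hST rfl
        · rw [hg, Set.pair_comm]
      · exact ⟨B, .refl, .single (Or.inr (step_of_cancels_unwinds f g hx hz hf hg))⟩
      · exact ⟨C, .single (Or.inr (step_of_cancels_unwinds g f hz hx hg hf)), .refl⟩
      · exact absurd rfl hST

theorem Normal.iso_of_red (hA : A.Normal) (h : Relation.ReflTransGen Red A B) : Iso A B := by
  induction h with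
  | refl => exact Iso.refl A
  | tail _ h ih =>
    rcases h with h | ⟨f, S, hS, -⟩
    · exact ih.trans h
    · exact absurd hS (ih.normal hA S)

/-- Equivalent systems in which no crossings can be removed are isomorphic. -/
theorem Normal.iso (hA : A.Normal) (hB : B.Normal) (h : Eqv A B) : Iso A B := by
  have he := Relation.equivalence_join_reflTransGen (r := Red (n := n))
    fun _ _ _ h h' => red_confluent h h'
  have hj : Relation.Join (Relation.ReflTransGen Red) A B := by
    clear hA hB
    induction h with
    | rel _ _ h => exact ⟨_, .single h, .refl⟩
    | refl => exact he.refl _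
    | symm _ _ _ ih => exact he.symm ih
    | trans _ _ _ _ _ ih ih' => exact he.trans ih ih'
  obtain ⟨C, hAC, hBC⟩ := hj
  exact (hA.iso_of_red hAC).trans (hB.iso_of_red hBC).symm

theorem Eqv.symm (h : Eqv A B) : Eqv B A := Relation.EqvGen.symm _ _ h

theorem Eqv.trans (h : Eqv A B) (h' : Eqv B C) : Eqv A C :=
  Relation.EqvGen.trans _ _ _ h h'

theorem Iso.eqv (h : Iso A B) : Eqv A B := Relation.EqvGen.rel _ _ (Or.inl h)

theorem Step.eqv (h : Step A B) : Eqv A B := Relation.EqvGen.rel _ _ (Or.inr h)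

/-- The crossing system with the marked points permuted. -/
def relabel (π : Equiv.Perm (Fin n)) (A : CrossingSystem n) : CrossingSystem n :=
  { A with
    lev := fun x => π (A.lev x)
    col := fun x => π (A.col x)
    cur_chains := fun x y => by rw [π.injective.eq_iff, A.cur_chains]
    stk_chains := fun x y => by rw [π.injective.eq_iff, A.stk_chains] }

/-- Embeddings are compatible with permutations of the marked points. -/
def Emb.relabel (π : Equiv.Perm (Fin n)) (f : Emb B A) :
    Emb (B.relabel π) (A.relabel π) where
  f := f.f
  inj := f.inj
  lev x := congrArg π (f.lev x)
  col x := congrArg π (f.col x)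
  up := f.up
  cur := f.cur
  stk := f.stk

theorem Redex.relabel (π : Equiv.Perm (Fin n)) {S : Set A.X} (h : A.Redex S) :
    (A.relabel π).Redex S := by
  rcases h with ⟨x, y, h, rfl⟩ | ⟨x, h, rfl⟩
  · exact Or.inl ⟨x, y, ⟨congrArg π h.col, congrArg π h.lev, h.up, h.cur, h.stk⟩, rfl⟩
  · exact Or.inr ⟨x, ⟨congrArg π h.col, h.cur, h.stk⟩, rfl⟩

theorem Eqv.relabel (π : Equiv.Perm (Fin n)) (h : Eqv A B) :
    Eqv (A.relabel π) (B.relabel π) := by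
  induction h with
  | rel _ _ h =>
    rcases h with ⟨f, hf⟩ | ⟨f, S, hS, hf⟩
    · exact Iso.eqv ⟨f.relabel π, hf⟩
    · exact Step.eqv ⟨f.relabel π, S, hS.relabel π, hf⟩
  | refl => exact (Iso.refl _).eqv
  | symm _ _ _ ih => exact ih.symm
  | trans _ _ _ _ _ ih ih' => exact ih.trans ih'

end CrossingSystem

/-! ### The crossing system of a diagram -/

namespace VCD

variable {n : ℕ} {D : VCD n}

/-- The point `c` lies strictly between `a` and `b`. -/
def Btw (D : VCD n) (a b c : D.P) : Prop := (D.ltP a c ∧ D.ltP c b) ∨ (D.ltP b c ∧ D.ltP c a)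

theorem btw_iff {a b c : D.P} (ha : a ∉ D.base) (hb : b ∉ D.base) (hc : c ∉ D.base) :
    D.Btw a b c ↔
      (D.pos a < D.pos c ∧ D.pos c < D.pos b) ∨ (D.pos b < D.pos c ∧ D.pos c < D.pos a) := by
  rw [Btw, ltP_iff ha hc, ltP_iff hc hb, ltP_iff hb hc, ltP_iff hc ha]

theorem not_base_of_idx {x : D.P} (h : D.idx x ≠ 0) : x ∉ D.base := mt base_iff_idx.1 h

theorem over_left {a b : D.P} (h : IsOverArc D.ltC a b) : a ∉ D.base :=
  not_base_of_idx (by have := isOverArc_iff.1 h; omega)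

theorem over_right {a b : D.P} (h : IsOverArc D.ltC a b) : b ∉ D.base :=
  not_base_of_idx (by have := isOverArc_iff.1 h; omega)

theorem pos_ne {x y : D.P} (hx : x ∉ D.base) (hy : y ∉ D.base) (h : x ≠ y) :
    D.pos x ≠ D.pos y :=
  mt (eq_of_pos hx hy) h

theorem over_not_terminal {a b : D.P} (h : IsOverArc D.ltC a b) : ¬ D.IsTerminal a :=
  fun h' => h' b h.1.1

/-- Two over arcs are equal, or they have different endpoints and do not cross. -/
theorem over_pair {a b c d : D.P} (h : IsOverArc D.ltC a b) (h' : IsOverArc D.ltC c d) :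
    (a = c ∧ b = d) ∨ (D.pos a ≠ D.pos c ∧ D.pos a ≠ D.pos d ∧ D.pos b ≠ D.pos c ∧
      D.pos b ≠ D.pos d ∧
      (((D.pos a < D.pos c ∧ D.pos c < D.pos b) ∨ (D.pos b < D.pos c ∧ D.pos c < D.pos a)) ↔
      ((D.pos a < D.pos d ∧ D.pos d < D.pos b) ∨ (D.pos b < D.pos d ∧ D.pos d < D.pos a)))) := by
  have ha := over_left h
  have hb := over_right h
  have hc := over_left h'
  have hd := over_right h'
  have i := isOverArc_iff.1 h
  have i' := isOverArc_iff.1 h'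
  by_cases hac : a = c
  · subst hac
    exact Or.inl ⟨rfl, eq_of_idx (i.1.symm.trans i'.1) (by omega)⟩
  right
  have n1 := pos_ne ha hc hac
  have n2 := pos_ne ha hd (by rintro rfl; omega)
  have n3 := pos_ne hb hc (by rintro rfl; omega)
  have n4 := pos_ne hb hd (by
    rintro rfl
    exact hac (eq_of_idx (i.1.trans i'.1.symm) (by omega)))
  refine ⟨n1, n2, n3, n4, ?_⟩
  -- `over_noncrossing` speaks of one left-to-right arrangement. Both orientations of each arc and
  -- both orders of the arcs give eight instances.
  have key : ∀ p q r s, (IsOverArc D.ltC p q ∨ IsOverArc D.ltC q p) →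
      (IsOverArc D.ltC r s ∨ IsOverArc D.ltC s r) → p ∉ D.base → q ∉ D.base → r ∉ D.base →
      s ∉ D.base → ¬ (D.pos p < D.pos r ∧ D.pos r < D.pos q ∧ D.pos q < D.pos s) := by
    intro p q r s h1 h2 hp hq hr hs
    rw [← ltP_iff hp hr, ← ltP_iff hr hq, ← ltP_iff hq hs]
    exact D.over_noncrossing p q r s h1 h2
  have k1 := key a b c d (.inl h) (.inl h') ha hb hc hd
  have k2 := key b a c d (.inr h) (.inl h') hb ha hc hd
  have k3 := key a b d c (.inl h) (.inr h') ha hb hd hc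
  have k4 := key b a d c (.inr h) (.inr h') hb ha hd hc
  have k5 := key c d a b (.inl h') (.inl h) hc hd ha hb
  have k6 := key c d b a (.inl h') (.inr h) hc hd hb ha
  have k7 := key d c a b (.inr h') (.inl h) hd hc ha hb
  have k8 := key d c b a (.inr h') (.inr h) hd hc hb ha
  omega

/-- A crossing: an over arc together with a terminal point below it. -/
@[ext]
structure Crossing (D : VCD n) where
  /-- the start of the over arc -/
  s : D.P
  /-- the end of the over arc -/
  e : D.P
  /-- the terminal point -/
  t : D.P
  arc : IsOverArc D.ltC s e
  ter : D.IsTerminal t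
  btw : D.Btw s e t

namespace Crossing

instance : Finite D.Crossing :=
  Finite.of_injective (fun x : D.Crossing => (x.s, x.e, x.t)) fun x y h => by
    simp only [Prod.mk.injEq] at h
    exact Crossing.ext h.1 h.2.1 h.2.2

variable (x y : D.Crossing)

theorem s_up : x.s ∉ D.base := over_left x.arc

theorem e_up : x.e ∉ D.base := over_right x.arc

theorem t_up : x.t ∉ D.base := terminal_not_base x.ter

theorem btw_pos : (D.pos x.s < D.pos x.t ∧ D.pos x.t < D.pos x.e) ∨
    (D.pos x.e < D.pos x.t ∧ D.pos x.t < D.pos x.s) :=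
  (btw_iff x.s_up x.e_up x.t_up).1 x.btw

variable {x y}

theorem e_eq (h : x.s = y.s) : x.e = y.e := by
  have i := isOverArc_iff.1 x.arc
  have i' := isOverArc_iff.1 y.arc
  rw [h] at i
  exact eq_of_idx (i.1.symm.trans i'.1) (by omega)

theorem ext' (h : x.s = y.s) (h' : x.t = y.t) : x = y := Crossing.ext h (e_eq h) h'

/-- The order of the crossings along the curves. -/
def Before (x y : D.Crossing) : Prop :=
  D.ltC x.s y.s ∨ (x.s = y.s ∧
    ((D.ltP x.s x.t ∧ D.ltP x.t y.t) ∨ (D.ltP x.t x.s ∧ D.ltP y.t x.t)))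

/-- The crossing `x` lies inside the crossing `y` over the same terminal point. -/
def Inside (x y : D.Crossing) : Prop := x.t = y.t ∧ D.Btw y.s y.e x.s

theorem before_iff : Before x y ↔ D.ltC x.s y.s ∨ (x.s = y.s ∧
    ((D.pos x.s < D.pos x.t ∧ D.pos x.t < D.pos y.t) ∨
      (D.pos x.t < D.pos x.s ∧ D.pos y.t < D.pos x.t))) := by
  rw [Before, ltP_iff x.s_up x.t_up, ltP_iff x.t_up y.t_up, ltP_iff x.t_up x.s_up,
    ltP_iff y.t_up x.t_up]

theorem inside_iff : Inside x y ↔ x.t = y.t ∧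
    ((D.pos y.s < D.pos x.s ∧ D.pos x.s < D.pos y.e) ∨
      (D.pos y.e < D.pos x.s ∧ D.pos x.s < D.pos y.s)) := by
  rw [Inside, btw_iff y.s_up y.e_up x.s_up]

end Crossing

open Crossing in
/-- The crossing system of a virtual curve diagram. -/
noncomputable def crossings (D : VCD n) : CrossingSystem n where
  X := D.Crossing
  finite_X := inferInstance
  lev x := crv x.t
  col x := crv x.s
  up x := D.ltP x.s x.t
  cur := Before
  stk := Inside
  cur_irrefl x := by
    rw [before_iff, ltC_iff]
    omega
  cur_trans x y z := by
    simp only [before_iff]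
    rintro (h | ⟨h, h'⟩) (k | ⟨k, k'⟩)
    · exact Or.inl (D.ltC_trans _ _ _ h k)
    · rw [k] at h; exact Or.inl h
    · rw [← h] at k; exact Or.inl k
    · refine Or.inr ⟨h.trans k, ?_⟩
      rw [← h] at k'
      omega
  cur_chains x y := by
    simp only [before_iff, crv_eq_iff]
    constructor
    · rintro (h | h | h)
      · exact Or.inl (congrArg _ h)
      · tauto
      · rw [eq_comm]; tauto
    · rintro (h | h | h)
      · by_cases ht : x.t = y.t
        · exact Or.inl (ext' h ht)
        · have := pos_ne x.t_up y.t_up ht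
          have hx := x.btw_pos
          have hy := y.btw_pos
          rw [← e_eq h, ← h] at hy
          simp only [h, true_and] at *
          omega
      · tauto
      · tauto
  stk_irrefl x := by
    rw [inside_iff]
    omega
  stk_trans x y z := by
    simp only [inside_iff]
    rintro ⟨h, h'⟩ ⟨k, k'⟩
    refine ⟨h.trans k, ?_⟩
    have hy := y.btw_pos
    have hz := z.btw_pos
    rcases over_pair z.arc y.arc with ⟨e1, e2⟩ | e
    · rw [e1, e2]; exact h'
    · omega
  stk_chains x y := by
    simp only [inside_iff]
    constructor
    · rintro (h | h | h)
      · rw [h]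
      · rw [h.1]
      · rw [h.1]
    · intro h
      have ht := terminal_ext x.ter y.ter h
      rcases over_pair x.arc y.arc with ⟨e1, e2⟩ | e
      · exact Or.inl (ext' e1 ht)
      · have hx := x.btw_pos
        have hy := y.btw_pos
        rw [← ht] at hy
        simp only [ht, true_and] at *
        omega

end VCD

namespace VCD

variable {n : ℕ} {D : VCD n}

/-- An injection onto the complement of `S` that is compatible with the order along the curves. -/
structure Deletion (D : VCD n) (S : Set D.P) {Q : Type} (ltC' : Q → Q → Prop)
    (f : Q → D.P) : Prop where
  inj : Function.Injective f
  range : Set.range f = Sᶜ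
  ltC : ∀ x y, D.ltC (f x) (f y) ↔ ltC' x y

namespace Deletion

variable {S : Set D.P} {Q : Type} {ltC' : Q → Q → Prop} {f : Q → D.P}

theorem notMem (h : D.Deletion S ltC' f) (x : Q) : f x ∉ S := by
  have : f x ∈ Sᶜ := h.range ▸ ⟨x, rfl⟩
  exact this

theorem exists_eq (h : D.Deletion S ltC' f) {y : D.P} (hy : y ∉ S) : ∃ x, f x = y := by
  have : y ∈ Set.range f := h.range ▸ hy
  exact this

/-- The points before `f x` are split into surviving and deleted ones. Only the parity of the
correction matters for over arcs. -/
theorem idx_eq (h : D.Deletion S ltC' f) (x : Q) :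
    D.idx (f x) = curveIndex ltC' x + {w | w ∈ S ∧ D.ltC w (f x)}.ncard := by
  have h1 : {w | D.ltC w (f x)} = f '' {z | ltC' z x} ∪ {w | w ∈ S ∧ D.ltC w (f x)} := by
    ext w
    simp only [Set.mem_ofPred_eq, Set.mem_union, Set.mem_image]
    constructor
    · intro hw
      by_cases hS : w ∈ S
      · exact Or.inr ⟨hS, hw⟩
      · obtain ⟨z, rfl⟩ := h.exists_eq hS
        exact Or.inl ⟨z, (h.ltC _ _).1 hw, rfl⟩
    · rintro (⟨z, hz, rfl⟩ | hw)
      · exact (h.ltC _ _).2 hz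
      · exact hw.2
  have h2 : Disjoint (f '' {z | ltC' z x}) {w | w ∈ S ∧ D.ltC w (f x)} := by
    rw [Set.disjoint_left]
    rintro _ ⟨z, -, rfl⟩ hw
    exact h.notMem z hw.1
  have : Finite Q := Finite.of_injective f h.inj
  have h3 := Set.ncard_union_eq h2 (Set.toFinite _) (Set.toFinite _)
  rw [← h1, Set.ncard_image_of_injective _ h.inj] at h3
  exact h3

theorem isArc_of_isArc (h : D.Deletion S ltC' f) {x y : Q} (ha : IsArc D.ltC (f x) (f y)) :
    IsArc ltC' x y :=
  ⟨(h.ltC _ _).1 ha.1, fun c hc => ha.2 (f c) ⟨(h.ltC _ _).2 hc.1, (h.ltC _ _).2 hc.2⟩⟩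

theorem T_idx {b : D.P} (h : D.Deletion {b} ltC' f) (hb : D.IsTerminal b) (x : Q) :
    D.idx (f x) = curveIndex ltC' x := by
  have : {w | w ∈ ({b} : Set D.P) ∧ D.ltC w (f x)} = ∅ := by
    ext w
    simp only [Set.mem_singleton_iff, Set.mem_ofPred_eq, Set.mem_empty_iff_false, iff_false]
    rintro ⟨rfl, hw⟩
    exact hb _ hw
  rw [h.idx_eq, this, Set.ncard_empty, add_zero]

theorem T_over {b : D.P} (h : D.Deletion {b} ltC' f) (hb : D.IsTerminal b) (x y : Q) :
    IsOverArc ltC' x y ↔ IsOverArc D.ltC (f x) (f y) := by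
  have hi : curveIndex D.ltC (f x) = curveIndex ltC' x := h.T_idx hb x
  rw [IsOverArc, IsOverArc, hi]
  refine and_congr_left fun _ => ⟨fun ha => ⟨(h.ltC _ _).2 ha.1, fun c hc => ?_⟩,
    h.isArc_of_isArc⟩
  by_cases hcb : c = b
  · subst hcb
    exact hb _ hc.2
  · obtain ⟨z, rfl⟩ := h.exists_eq (y := c) hcb
    exact ha.2 z ⟨(h.ltC _ _).1 hc.1, (h.ltC _ _).1 hc.2⟩

theorem B_idx {b c : D.P} (h : D.Deletion {b, c} ltC' f) (hbc : IsArc D.ltC b c) (x : Q) :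
    D.idx (f x) = curveIndex ltC' x ∨
      (D.idx (f x) = curveIndex ltC' x + 2 ∧ D.ltC c (f x)) := by
  have hx := h.notMem x
  simp only [Set.mem_insert_iff, Set.mem_singleton_iff, not_or] at hx
  rw [isArc_iff] at hbc
  have hne : b ≠ c := by rintro rfl; omega
  rw [h.idx_eq]
  by_cases hc : D.ltC c (f x)
  · right
    have : {w | w ∈ ({b, c} : Set D.P) ∧ D.ltC w (f x)} = {b, c} := by
      ext w
      simp only [Set.mem_insert_iff, Set.mem_singleton_iff, Set.mem_ofPred_eq,
        and_iff_left_iff_imp]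
      rintro (rfl | rfl)
      · exact D.ltC_trans _ _ _ (ltC_iff.2 ⟨hbc.1, by omega⟩) hc
      · exact hc
    rw [this, Set.ncard_pair hne]
    exact ⟨rfl, hc⟩
  · left
    have : {w | w ∈ ({b, c} : Set D.P) ∧ D.ltC w (f x)} = ∅ := by
      ext w
      simp only [Set.mem_insert_iff, Set.mem_singleton_iff, Set.mem_ofPred_eq,
        Set.mem_empty_iff_false, iff_false]
      rintro ⟨rfl | rfl, hw⟩
      · rw [ltC_iff] at hw hc
        refine hx.2 (eq_of_idx (hw.1.symm.trans hbc.1) ?_)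
        have : crv c = crv (f x) := hbc.1.symm.trans hw.1
        have hlt : ¬ D.idx c < D.idx (f x) := fun h => hc ⟨this, h⟩
        omega
      · exact hc hw
    rw [this, Set.ncard_empty, add_zero]

/-- Indices of the remaining points drop by `0` or `2`, so parities survive. The only new covering
pair is the one that bridges the gap left by `b` and `c`. -/
theorem B_over {a b c d : D.P} (h : D.Deletion {b, c} ltC' f) (hab : IsArc D.ltC a b)
    (hbc : IsArc D.ltC b c) (hcd : IsArc D.ltC c d) (x y : Q) :
    IsOverArc ltC' x y ↔ IsOverArc D.ltC (f x) (f y) ∨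
      (f x = a ∧ f y = d ∧ D.idx a % 2 = 1) := by
  have hodd : Odd (curveIndex ltC' x) ↔ D.idx (f x) % 2 = 1 := by
    rw [Nat.odd_iff]
    rcases h.B_idx hbc x with e | ⟨e, -⟩ <;> rw [e]
    omega
  have hodd' : Odd (curveIndex D.ltC (f x)) ↔ D.idx (f x) % 2 = 1 := Nat.odd_iff
  have hx := h.notMem x
  have hy := h.notMem y
  rw [isArc_iff] at hab hbc hcd
  simp only [Set.mem_insert_iff, Set.mem_singleton_iff, not_or] at hx hy
  rw [IsOverArc, IsOverArc, hodd, hodd']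
  constructor
  · rintro ⟨ha, ho⟩
    by_cases hD : IsArc D.ltC (f x) (f y)
    · exact Or.inl ⟨hD, ho⟩
    right
    have hlt := (h.ltC _ _).2 ha.1
    have hz : ∀ w, D.ltC (f x) w → D.ltC w (f y) → w = b ∨ w = c := by
      intro w h1 h2
      by_contra hw
      obtain ⟨z, rfl⟩ := h.exists_eq (y := w) hw
      exact ha.2 z ⟨(h.ltC _ _).1 h1, (h.ltC _ _).1 h2⟩
    have hw : ∃ w, D.ltC (f x) w ∧ D.ltC w (f y) := by
      by_contra hw
      push Not at hw
      exact hD ⟨hlt, fun c hc => hw c hc.1 hc.2⟩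
    simp only [ltC_iff] at hz hw hlt
    have nxb := fun e => mt (eq_of_idx (x := f x) (y := b) e) hx.1
    have nxc := fun e => mt (eq_of_idx (x := f x) (y := c) e) hx.2
    have nyb := fun e => mt (eq_of_idx (x := f y) (y := b) e) hy.1
    have nyc := fun e => mt (eq_of_idx (x := f y) (y := c) e) hy.2
    have hcb : crv (f x) = crv b ∧ D.idx (f x) < D.idx b ∧ D.idx c < D.idx (f y) := by
      obtain ⟨w, h1, h2⟩ := hw
      rcases hz w h1 h2 with rfl | rfl
      · have := nyc (by rw [← hbc.1, h2.1])
        exact ⟨h1.1, h1.2, by omega⟩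
      · have := nxb (by rw [hbc.1, h1.1])
        exact ⟨h1.1.trans hbc.1.symm, by omega, h2.2⟩
    have hyb : crv (f y) = crv b := by rw [← hlt.1, hcb.1]
    have hxa : f x = a := by
      refine eq_of_idx (by rw [hcb.1, hab.1]) ?_
      by_contra hne
      rcases hz a ⟨by rw [hcb.1, hab.1], by omega⟩ ⟨by rw [hab.1, hyb], by omega⟩ with rfl | rfl <;>
      omega
    have hyd : f y = d := by
      refine eq_of_idx (by rw [hyb, hbc.1, hcd.1]) ?_
      by_contra hne
      have e : crv d = crv b := by rw [← hcd.1, hbc.1]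
      rcases hz d ⟨by rw [hcb.1, e], by omega⟩ ⟨by rw [e, hyb], by omega⟩ with rfl | rfl <;>
      omega
    exact ⟨hxa, hyd, hxa ▸ ho⟩
  · rintro (⟨ha, ho⟩ | ⟨rfl, rfl, ho⟩)
    · exact ⟨h.isArc_of_isArc ha, ho⟩
    · refine ⟨⟨(h.ltC _ _).1 (ltC_iff.2 ⟨?_, by omega⟩), fun z hz => ?_⟩, ho⟩
      · rw [hab.1, hbc.1, hcd.1]
      · have hz' := h.notMem z
        simp only [Set.mem_insert_iff, Set.mem_singleton_iff, not_or] at hz'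
        rw [← h.ltC, ← h.ltC, ltC_iff, ltC_iff] at hz
        have e1 : crv (f z) = crv b := by rw [← hz.1.1, hab.1]
        have n1 := mt (eq_of_idx e1) hz'.1
        have n2 := mt (eq_of_idx (e1.trans hbc.1)) hz'.2
        omega

end Deletion

/-- The diagram with the points in `S` deleted. -/
def delete (D : VCD n) (S : Set D.P) (hbase : ∀ a ∈ D.base, a ∉ S)
    (hmin : ∀ a, a ∉ S → (∀ b, b ∉ S → ¬ D.ltC b a) → a ∈ D.base)
    (hmax : ∀ a, a ∉ S → (∀ b, b ∉ S → ¬ D.ltC a b) → a ∉ D.base)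
    (hover : ∀ p q r s : {x // x ∉ S},
      (IsOverArc (fun x y : {x // x ∉ S} => D.ltC x y) p q ∨
        IsOverArc (fun x y : {x // x ∉ S} => D.ltC x y) q p) →
      (IsOverArc (fun x y : {x // x ∉ S} => D.ltC x y) r s ∨
        IsOverArc (fun x y : {x // x ∉ S} => D.ltC x y) s r) →
      ¬ (D.ltP p r ∧ D.ltP r q ∧ D.ltP q s)) : VCD n where
  P := {x // x ∉ S}
  finite_P := inferInstance
  base := {x | x.1 ∈ D.base}
  ltP x y := D.ltP x y
  ltC x y := D.ltC x y
  ltP_irrefl a := D.ltP_irrefl a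
  ltP_trans a b c := D.ltP_trans a b c
  ltP_chains a b := by rw [Subtype.ext_iff]; exact D.ltP_chains a b
  ltC_irrefl a := D.ltC_irrefl a
  ltC_trans a b c := D.ltC_trans a b c
  ltC_chains a b c := by simp only [Subtype.ext_iff]; exact D.ltC_chains a b c
  card_base := by
    refine Eq.trans ?_ D.card_base
    rw [← Set.ncard_image_of_injective _ Subtype.val_injective]
    congr 1
    ext x
    simp only [Set.mem_image, Subtype.exists]
    exact ⟨fun ⟨a, _, h, e⟩ => e ▸ h, fun h => ⟨x, hbase x h, h, rfl⟩⟩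
  base_iff a := ⟨fun h b => (D.base_iff a).1 h b, fun h => hmin a a.2 fun b hb => h ⟨b, hb⟩⟩
  terminal_upper a h := hmax a a.2 fun b hb => h ⟨b, hb⟩
  over_noncrossing := hover

theorem deletion_val (S : Set D.P) :
    D.Deletion S (fun x y : {x // x ∉ S} => D.ltC x y) Subtype.val :=
  ⟨Subtype.val_injective, Subtype.range_val, fun _ _ => Iff.rfl⟩

theorem card_compl_lt {S : Set D.P} (h : S.Nonempty) : Nat.card {x // x ∉ S} < Nat.card D.P := by
  obtain ⟨x, hx⟩ := h
  exact Finite.card_subtype_lt (x := x) (by simpa using hx)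

/-- A simplified diagram does not admit a `T`-move. -/
theorem Simplified.no_T (h : D.Simplified) {a b : D.P} (hab : IsArc D.ltC a b)
    (hb : D.IsTerminal b) (hadj : D.Adjacent a b) (ha : D.idx a ≠ 0) : False := by
  have hdel := deletion_val (D := D) {b}
  have hab' := isArc_iff.1 hab
  let E := D.delete {b} (by
      rintro x hx rfl
      rw [base_iff_idx] at hx; omega) (by
      intro x hx hmin
      rw [D.base_iff]
      intro y hy
      refine hmin y ?_ hy
      rintro rfl
      exact hb _ hy) (by
      intro x hx hmax
      by_cases hxt : D.IsTerminal x
      · exact D.terminal_upper x hxt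
      -- The only new end of a curve is `a`, and `ha` keeps it off the base line.
      · obtain ⟨y, hy⟩ := exists_isArc_right hxt
        have : y = b := by
          by_contra hyb
          exact hmax y hyb hy.1
        subst this
        have := isArc_iff.1 hy
        rw [base_iff_idx]; omega) (by
      intro p q r s h1 h2
      simp only [hdel.T_over hb] at h1 h2
      exact D.over_noncrossing p q r s h1 h2)
  have hT : D.TMove E :=
    ⟨a, b, hab, hb, hadj, Subtype.val, Subtype.val_injective, Subtype.range_val,
      fun _ _ => Iff.rfl, fun _ _ => Iff.rfl⟩
  have h1 := h E (.rel _ _ (.inr (.inl hT)))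
  have h2 := card_compl_lt (Set.singleton_nonempty b)
  exact absurd h1 (not_le.2 h2)

theorem adjacent_pos {b c : D.P} (hb : b ∉ D.base) (hc : c ∉ D.base) (h : D.Adjacent b c) {z : D.P}
    (hz : z ∉ D.base) : ¬ (D.pos b < D.pos z ∧ D.pos z < D.pos c) ∧
      ¬ (D.pos c < D.pos z ∧ D.pos z < D.pos b) := by
  rw [← ltP_iff hb hz, ← ltP_iff hz hc, ← ltP_iff hc hz, ← ltP_iff hz hb]
  exact h z

/-- If both or none of `x`, `y` lie between `a` and `d`, then the two pairs do not cross. -/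
theorem not_linked {a d x y p q r s : ℕ}
    (h : ((a < x ∧ x < d) ∨ (d < x ∧ x < a)) ↔ ((a < y ∧ y < d) ∨ (d < y ∧ y < a)))
    (h1 : (p = a ∧ q = d) ∨ (q = a ∧ p = d)) (h2 : (r = x ∧ s = y) ∨ (s = x ∧ r = y)) :
    ¬ (p < r ∧ r < q ∧ q < s) ∧ ¬ (r < p ∧ p < s ∧ s < q) := by
  rcases h1 with ⟨rfl, rfl⟩ | ⟨rfl, rfl⟩ <;> rcases h2 with ⟨rfl, rfl⟩ | ⟨rfl, rfl⟩ <;> omega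

/-- The over arc obtained by joining `(a, b)` and `(c, d)`, with `b` and `c` adjacent, does not
cross the other over arcs. -/
theorem over_pair_join {a b c d x y : D.P} (hab : IsOverArc D.ltC a b)
    (hcd : IsOverArc D.ltC c d) (hadj : D.Adjacent b c) (h : IsOverArc D.ltC x y)
    (hxc : x ≠ c) (hyb : y ≠ b) :
    D.pos a ≠ D.pos x ∧ D.pos a ≠ D.pos y ∧ D.pos d ≠ D.pos x ∧ D.pos d ≠ D.pos y ∧
      (((D.pos a < D.pos x ∧ D.pos x < D.pos d) ∨ (D.pos d < D.pos x ∧ D.pos x < D.pos a)) ↔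
      ((D.pos a < D.pos y ∧ D.pos y < D.pos d) ∨ (D.pos d < D.pos y ∧ D.pos y < D.pos a))) := by
  have hb := over_right hab
  have hc := over_left hcd
  rcases over_pair hab h with ⟨-, e⟩ | h1
  · exact absurd e.symm hyb
  rcases over_pair hcd h with ⟨e, -⟩ | h2
  · exact absurd e.symm hxc
  have h3 := adjacent_pos hb hc hadj (over_left h)
  have h4 := adjacent_pos hb hc hadj (over_right h)
  refine ⟨by omega, by omega, by omega, by omega, ?_⟩
  omega

/-- A simplified diagram does not admit a `B`-move. -/
theorem Simplified.no_B (h : D.Simplified) {a b c d : D.P} (hab : IsArc D.ltC a b)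
    (hbc : IsArc D.ltC b c) (hcd : IsArc D.ltC c d) (hadj : D.Adjacent b c) : False := by
  have hdel := deletion_val (D := D) {b, c}
  have hab' := isArc_iff.1 hab
  have hbc' := isArc_iff.1 hbc
  have hcd' := isArc_iff.1 hcd
  have hmem : ∀ x, x ∉ ({b, c} : Set D.P) ↔ x ≠ b ∧ x ≠ c := by
    intro x; simp [not_or]
  have ha : a ≠ b ∧ a ≠ c := by constructor <;> (rintro rfl; omega)
  have hd : d ≠ b ∧ d ≠ c := by constructor <;> (rintro rfl; omega)
  let E := D.delete {b, c} (by
      intro x hx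
      rw [hmem]
      rw [base_iff_idx] at hx
      constructor <;> (rintro rfl; omega)) (by
      intro x hx hmin
      rw [D.base_iff]
      intro y hy
      by_cases hyb : y = b ∨ y = c
      · refine hmin a ((hmem a).2 ha) ?_
        rw [ltC_iff] at hy ⊢
        rcases hyb with rfl | rfl
        · exact ⟨hab'.1.trans hy.1, by omega⟩
        · exact ⟨(hab'.1.trans hbc'.1).trans hy.1, by omega⟩
      · exact hmin y hyb hy) (by
      intro x hx hmax
      refine D.terminal_upper x fun y hy => ?_
      by_cases hyb : y = b ∨ y = c
      · refine hmax d ((hmem d).2 hd) ?_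
        rw [ltC_iff] at hy ⊢
        rcases hyb with rfl | rfl
        · exact ⟨(hy.1.trans hbc'.1).trans hcd'.1, by omega⟩
        · exact ⟨hy.1.trans hcd'.1, by omega⟩
      · exact hmax y hyb hy) (by
      intro p q r s h1 h2
      simp only [hdel.B_over hab hbc hcd] at h1 h2
      have hp := p.2
      have hq := q.2
      have hr := r.2
      have hs := s.2
      simp only [hmem] at hp hq hr hs
      have hjoin : ∀ x y : D.P, D.idx a % 2 = 1 → IsOverArc D.ltC x y → x ≠ c → y ≠ b → _ :=
        fun x y ho hxy h1 h2 => over_pair_join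
          (isOverArc_iff.2 ⟨hab'.1, hab'.2, ho⟩)
          (isOverArc_iff.2 ⟨hcd'.1, hcd'.2, by omega⟩) hadj hxy h1 h2
      have h3 : (IsOverArc D.ltC p q ∨ IsOverArc D.ltC q p) ∨
          (D.idx a % 2 = 1 ∧ ((p.1 = a ∧ q.1 = d) ∨ (q.1 = a ∧ p.1 = d))) := by
        rcases h1 with (e | ⟨e1, e2, e3⟩) | (e | ⟨e1, e2, e3⟩)
        · exact .inl (.inl e)
        · exact .inr ⟨e3, .inl ⟨e1, e2⟩⟩
        · exact .inl (.inr e)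
        · exact .inr ⟨e3, .inr ⟨e1, e2⟩⟩
      have h4 : (IsOverArc D.ltC r s ∨ IsOverArc D.ltC s r) ∨
          (D.idx a % 2 = 1 ∧ ((r.1 = a ∧ s.1 = d) ∨ (s.1 = a ∧ r.1 = d))) := by
        rcases h2 with (e | ⟨e1, e2, e3⟩) | (e | ⟨e1, e2, e3⟩)
        · exact .inl (.inl e)
        · exact .inr ⟨e3, .inl ⟨e1, e2⟩⟩
        · exact .inl (.inr e)
        · exact .inr ⟨e3, .inr ⟨e1, e2⟩⟩
      intro hl'
      have hl : D.pos p < D.pos r ∧ D.pos r < D.pos q ∧ D.pos q < D.pos s :=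
        ⟨pos_lt hl'.1, pos_lt hl'.2.1, pos_lt hl'.2.2⟩
      -- Two old arcs do not cross in `D`, an old arc does not cross the joined one by
      -- `over_pair_join`, and the joined arc cannot cross itself.
      rcases h3 with h3 | ⟨ho, h3⟩
      · rcases h4 with h4 | ⟨ho, h4⟩
        · exact D.over_noncrossing p q r s h3 h4 hl'
        · have e : (D.pos r = D.pos a ∧ D.pos s = D.pos d) ∨
              (D.pos s = D.pos a ∧ D.pos r = D.pos d) := by
            rcases h4 with ⟨e1, e2⟩ | ⟨e1, e2⟩ <;> simp only [e1, e2, and_self, true_or, or_true]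
          rcases h3 with h3 | h3
          · exact (not_linked (hjoin _ _ ho h3 hp.2 hq.1).2.2.2.2 e (.inl ⟨rfl, rfl⟩)).2 hl
          · exact (not_linked (hjoin _ _ ho h3 hq.2 hp.1).2.2.2.2 e (.inr ⟨rfl, rfl⟩)).2 hl
      · have e : (D.pos p = D.pos a ∧ D.pos q = D.pos d) ∨
            (D.pos q = D.pos a ∧ D.pos p = D.pos d) := by
          rcases h3 with ⟨e1, e2⟩ | ⟨e1, e2⟩ <;> simp only [e1, e2, and_self, true_or, or_true]
        rcases h4 with h4 | ⟨-, h4⟩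
        · rcases h4 with h4 | h4
          · exact (not_linked (hjoin _ _ ho h4 hr.2 hs.1).2.2.2.2 e (.inl ⟨rfl, rfl⟩)).1 hl
          · exact (not_linked (hjoin _ _ ho h4 hs.2 hr.1).2.2.2.2 e (.inr ⟨rfl, rfl⟩)).1 hl
        · have e' : (D.pos r = D.pos a ∧ D.pos s = D.pos d) ∨
              (D.pos s = D.pos a ∧ D.pos r = D.pos d) := by
            rcases h4 with ⟨e1, e2⟩ | ⟨e1, e2⟩ <;> simp only [e1, e2, and_self, true_or, or_true]
          clear hjoin h1 h2
          omega)
  have hB : D.BMove E :=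
    ⟨a, b, c, d, hab, hbc, hcd, hadj, Subtype.val, Subtype.val_injective, Subtype.range_val,
      fun _ _ => Iff.rfl, fun _ _ => Iff.rfl⟩
  have h1 := h E (.rel _ _ (.inr (.inr hB)))
  have h2 := card_compl_lt (Set.insert_nonempty b {c})
  exact absurd h1 (not_le.2 h2)

end VCD

/-! ### Simplified diagrams have normal crossing systems -/

namespace VCD

variable {n : ℕ} {D : VCD n}

theorem adjacent_of_pos {a b : D.P} (ha : a ∉ D.base) (hb : b ∉ D.base)
    (h : ∀ z, z ∉ D.base → (D.pos a < D.pos z ∧ D.pos z < D.pos b) ∨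
      (D.pos b < D.pos z ∧ D.pos z < D.pos a) → False) : D.Adjacent a b := by
  intro z
  by_cases hz : z ∈ D.base
  · constructor
    · rintro ⟨h1, -⟩
      exact ha ((not_base_of_ltP h1).2 hz)
    · rintro ⟨h1, -⟩
      exact hb ((not_base_of_ltP h1).2 hz)
  · constructor
    · rintro ⟨h1, h2⟩
      exact h z hz (.inl ⟨pos_lt h1, pos_lt h2⟩)
    · rintro ⟨h1, h2⟩
      exact h z hz (.inr ⟨pos_lt h1, pos_lt h2⟩)

/-- Every upper point that is not terminal is an endpoint of an over arc. -/
theorem exists_over {p : D.P} (hp : p ∉ D.base) (ht : ¬ D.IsTerminal p) :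
    ∃ q, IsOverArc D.ltC p q ∨ IsOverArc D.ltC q p := by
  rw [base_iff_idx] at hp
  obtain ⟨c, h1, h2⟩ := exists_pred hp
  obtain ⟨d, h3, h4⟩ := exists_succ ht
  simp only [isOverArc_iff]
  rcases Nat.mod_two_eq_zero_or_one (D.idx p) with h | h
  · exact ⟨c, .inr ⟨h1, h2, by omega⟩⟩
  · exact ⟨d, .inl ⟨h3, h4, h⟩⟩

theorem exists_over_of_odd {a : D.P} (ht : ¬ D.IsTerminal a) (h : D.idx a % 2 = 1) :
    ∃ b, IsOverArc D.ltC a b := by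
  obtain ⟨d, h3, h4⟩ := exists_succ ht
  exact ⟨d, isOverArc_iff.2 ⟨h3, h4, h⟩⟩

/-- In a simplified diagram every over arc encloses a terminal point. -/
theorem Simplified.exists_crossing (h : D.Simplified) {a b : D.P} (hab : IsOverArc D.ltC a b) :
    ∃ x : D.Crossing, x.s = a ∧ x.e = b := by
  by_contra hne
  have hne' : ∀ t, D.IsTerminal t → (D.pos a < D.pos t ∧ D.pos t < D.pos b) ∨
      (D.pos b < D.pos t ∧ D.pos t < D.pos a) → False := fun t ht hbt =>
    hne ⟨⟨a, b, t, hab, ht, (btw_iff (over_left hab) (over_right hab)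
      (terminal_not_base ht)).2 hbt⟩, rfl, rfl⟩
  clear hne
  -- An innermost-arc argument: with truncated subtraction this sum is the distance between the
  -- endpoints.
  induction hm : (D.pos a - D.pos b) + (D.pos b - D.pos a) using Nat.strong_induction_on
    generalizing a b with
  | _ m ih =>
  subst hm
  have key : ∀ p q, IsOverArc D.ltC p q →
      ((D.pos a < D.pos p ∧ D.pos p < D.pos b) ∨ (D.pos b < D.pos p ∧ D.pos p < D.pos a)) →
      ((D.pos a < D.pos q ∧ D.pos q < D.pos b) ∨ (D.pos b < D.pos q ∧ D.pos q < D.pos a)) →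
      False := fun p q hpq h1 h2 =>
    ih _ (by omega) hpq (fun t ht h3 => hne' t ht (by omega)) rfl
  -- A point between `a` and `b` would not be terminal, hence would belong to an over arc. That arc
  -- is nested and shorter, and encloses no terminal point either.
  have hadj : D.Adjacent a b := by
    refine adjacent_of_pos (over_left hab) (over_right hab) fun p hp hpos => ?_
    obtain ⟨q, hq | hq⟩ := exists_over hp fun ht => hne' p ht hpos
    · rcases over_pair hab hq with ⟨rfl, rfl⟩ | hr
      · omega
      · exact key p q hq hpos (hr.2.2.2.2.1 hpos)
    · rcases over_pair hab hq with ⟨rfl, rfl⟩ | hr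
      · omega
      · exact key q p hq (hr.2.2.2.2.2 hpos) hpos
  have hi := isOverArc_iff.1 hab
  by_cases hb : D.IsTerminal b
  · exact h.no_T hab.1 hb hadj (by omega)
  · obtain ⟨z, hz⟩ := exists_isArc_left (y := a) (by omega)
    obtain ⟨d, hd⟩ := exists_isArc_right hb
    exact h.no_B hz hab.1 hd hadj

/-- If the arcs `(a, b)` and `(c, d)` cross `t` in opposite directions, then any third arc across `t`
that ends between `b` and `c` is nested between them. -/
theorem nested_of_gap {a b c d t p q : ℕ} (hx : (a < t ∧ t < b) ∨ (b < t ∧ t < a))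
    (hy : (c < t ∧ t < d) ∨ (d < t ∧ t < c)) (hup : ¬ (a < t ↔ c < t))
    (h1 : a ≠ p ∧ a ≠ q ∧ b ≠ p ∧ b ≠ q ∧
      (((a < p ∧ p < b) ∨ (b < p ∧ p < a)) ↔ ((a < q ∧ q < b) ∨ (b < q ∧ q < a))))
    (h2 : c ≠ p ∧ c ≠ q ∧ d ≠ p ∧ d ≠ q ∧
      (((c < p ∧ p < d) ∨ (d < p ∧ p < c)) ↔ ((c < q ∧ q < d) ∨ (d < q ∧ q < c))))
    (hpos : ((b < p ∧ p < c) ∨ (c < p ∧ p < b)) ∨ ((b < q ∧ q < c) ∨ (c < q ∧ q < b)))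
    (hin : (p < t ∧ t < q) ∨ (q < t ∧ t < p)) :
    (((p < a ∧ a < q) ∨ (q < a ∧ a < p)) ∧ ((c < p ∧ p < d) ∨ (d < p ∧ p < c))) ∨
    (((p < c ∧ c < q) ∨ (q < c ∧ c < p)) ∧ ((a < p ∧ p < b) ∨ (b < p ∧ p < a))) := by
  obtain ⟨e1, e2, e3, e4, h1⟩ := h1
  obtain ⟨f1, f2, f3, f4, h2⟩ := h2
  rcases hx with hx | hx <;> rcases hy with hy | hy <;> rcases hin with hin | hin <;>
  first
  | exact absurd hup (by omega)
  | (rcases hpos with (hpos | hpos) | (hpos | hpos) <;> omega)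

/-- If `x` comes first, cancellation forces the two over arcs to be separated by a single arc `(x.e,
y.s)` whose endpoints are adjacent. This arc then admits a `B`-move. -/
theorem Simplified.not_cancels (h : D.Simplified) (x y : D.Crossing)
    (hc : D.crossings.Cancels x y) : False := by
  wlog hxy : x.Before y generalizing x y with H
  · rcases (D.crossings.cur_chains x y).2 hc.col with e | e | e
    · exact hc.ne e
    · exact hxy e
    · exact H y x hc.symm e
  have ht : x.t = y.t := terminal_ext x.ter y.ter hc.lev
  have hcur : ∀ z : D.Crossing, x.Before z → z.Before y → False :=
    fun z h1 h2 => (hc.cur z).1 ⟨h1, h2⟩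
  have hstk : ∀ z : D.Crossing, z.t = x.t →
      ((x.Inside z ∧ z.Inside y) ∨ (y.Inside z ∧ z.Inside x)) → False := by
    intro z _ hz
    rcases hz with hz | hz
    · exact (hc.stk z).1 hz
    · exact (hc.stk z).2 hz
  simp only [Crossing.before_iff, Crossing.inside_iff, ltC_iff] at hxy hcur hstk
  have hup : ¬ (D.ltP x.s x.t ↔ D.ltP y.s y.t) := hc.up
  rw [ltP_iff x.s_up x.t_up, ltP_iff y.s_up y.t_up, ← ht] at hup
  have hxs : x.s ≠ y.s := fun e => hc.ne (Crossing.ext' e ht)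
  simp only [hxs, false_and, or_false] at hxy
  have ix := isOverArc_iff.1 x.arc
  have iy := isOverArc_iff.1 y.arc
  have hbnt : ¬ D.IsTerminal x.e := fun hb => by
    have := terminal_idx hb (x := y.s) (by rw [← hxy.1, ix.1]); omega
  -- Otherwise another over arc comes in between on the curve, and by `exists_crossing` it
  -- contributes a crossing between `x` and `y`.
  have hidx : D.idx y.s = D.idx x.e + 1 := by
    by_contra hne
    obtain ⟨c, hc1, hc2⟩ := exists_succ hbnt
    have hcnt : ¬ D.IsTerminal c := fun hb => by
      have := terminal_idx hb (x := y.s) (by rw [← hxy.1, ix.1, hc1]); omega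
    obtain ⟨d, hd⟩ := exists_over_of_odd hcnt (by omega)
    obtain ⟨z, rfl, rfl⟩ := h.exists_crossing hd
    exact hcur z (.inl ⟨by rw [ix.1, hc1], by omega⟩)
      (.inl ⟨by rw [← hc1, ← ix.1, hxy.1], by omega⟩)
  have px := x.btw_pos
  have py := y.btw_pos
  rw [← ht] at py
  -- A terminal point in the gap is crossed either by the first arc after `x` or by the second one
  -- before `y`.
  have hterm : ∀ z, D.IsTerminal z → (D.pos x.e < D.pos z ∧ D.pos z < D.pos y.s) ∨
      (D.pos y.s < D.pos z ∧ D.pos z < D.pos x.e) → False := by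
    intro z hz hpos
    have hzu := terminal_not_base hz
    by_cases hin : (D.pos x.s < D.pos z ∧ D.pos z < D.pos x.e) ∨
      (D.pos x.e < D.pos z ∧ D.pos z < D.pos x.s)
    · exact hcur ⟨x.s, x.e, z, x.arc, hz, (btw_iff x.s_up x.e_up hzu).2 hin⟩
        (.inr ⟨rfl, by simp only; omega⟩) (.inl hxy)
    · refine hcur ⟨y.s, y.e, z, y.arc, hz, (btw_iff y.s_up y.e_up hzu).2 (by omega)⟩
        (.inl hxy) (.inr ⟨rfl, by simp only; rw [← ht]; omega⟩)
  have hover : ∀ p q, IsOverArc D.ltC p q →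
      ((D.pos x.e < D.pos p ∧ D.pos p < D.pos y.s) ∨
        (D.pos y.s < D.pos p ∧ D.pos p < D.pos x.e)) ∨
      ((D.pos x.e < D.pos q ∧ D.pos q < D.pos y.s) ∨
        (D.pos y.s < D.pos q ∧ D.pos q < D.pos x.e)) → False := by
    intro p q hpq hpos
    rcases over_pair x.arc hpq with ⟨e1, e2⟩ | h1
    · rw [← e1, ← e2] at hpos; omega
    rcases over_pair y.arc hpq with ⟨e1, e2⟩ | h2
    · rw [← e1, ← e2] at hpos; omega
    -- An arc over `x.t` with an end in the gap lies between `x` and `y` in the stack. An arc that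
    -- misses `x.t` must enclose some terminal point, which is then in the gap itself.
    by_cases hin : (D.pos p < D.pos x.t ∧ D.pos x.t < D.pos q) ∨
        (D.pos q < D.pos x.t ∧ D.pos x.t < D.pos p)
    · refine hstk ⟨p, q, x.t, hpq, x.ter, (btw_iff (over_left hpq) (over_right hpq) x.t_up).2 hin⟩
        rfl ?_
      simp only [← ht, true_and]
      exact nested_of_gap px py hup h1 h2 hpos hin
    · obtain ⟨z, rfl, rfl⟩ := h.exists_crossing hpq
      have := z.btw_pos
      have hzt : D.pos z.s ≠ D.pos x.t := pos_ne z.s_up x.t_up fun e =>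
        over_not_terminal z.arc (e ▸ x.ter)
      refine hterm z.t z.ter ?_
      clear hterm hcur hstk ix iy hidx hxy
      obtain ⟨-, -, -, -, h1⟩ := h1
      obtain ⟨-, -, -, -, h2⟩ := h2
      rcases px with px | px <;> rcases py with py | py <;> rcases this with this | this <;> omega
  refine h.no_B x.arc.1 (isArc_iff.2 ⟨by rw [← ix.1, hxy.1], hidx⟩) y.arc.1
    (adjacent_of_pos x.e_up y.s_up fun p hp hpos => ?_)
  by_cases hpt : D.IsTerminal p
  · exact hterm p hpt hpos
  · obtain ⟨q, hq | hq⟩ := exists_over hp hpt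
    · exact hover p q hq (.inl hpos)
    · exact hover q p hq (.inr hpos)

/-- No over arc can follow the last crossing's arc, so the curve goes on from `x.e` straight to its
end `x.t`. As in `not_cancels`, the gap between these points is empty, and the terminal arc admits a
`T`-move. -/
theorem Simplified.not_unwinds (h : D.Simplified) (x : D.Crossing)
    (hu : D.crossings.Unwinds x) : False := by
  have hcur : ∀ z : D.Crossing, ¬ x.Before z := hu.cur
  have hstk : ∀ z : D.Crossing, ¬ z.Inside x := hu.stk
  have hcol : crv x.s = crv x.t := hu.col
  simp only [Crossing.before_iff, Crossing.inside_iff, ltC_iff] at hcur hstk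
  have ix := isOverArc_iff.1 x.arc
  have px := x.btw_pos
  have hbnt : ¬ D.IsTerminal x.e := fun hb => by
    have := terminal_ext hb x.ter (by rw [← ix.1, hcol])
    rw [this] at px
    omega
  obtain ⟨d, hd1, hd2⟩ := exists_succ hbnt
  have hdt : D.IsTerminal d := by
    by_contra hd
    obtain ⟨d', hd'⟩ := exists_over_of_odd hd (by omega)
    obtain ⟨z, rfl, rfl⟩ := h.exists_crossing hd'
    exact hcur z (.inl ⟨by rw [ix.1, hd1], by omega⟩)
  obtain rfl : d = x.t := terminal_ext hdt x.ter (by rw [← hd1, ← ix.1, hcol])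
  have hterm : ∀ z, D.IsTerminal z → (D.pos x.e < D.pos z ∧ D.pos z < D.pos x.t) ∨
      (D.pos x.t < D.pos z ∧ D.pos z < D.pos x.e) → False := by
    intro z hz hpos
    exact hcur ⟨x.s, x.e, z, x.arc, hz,
      (btw_iff x.s_up x.e_up (terminal_not_base hz)).2 (by omega)⟩
      (.inr ⟨rfl, by simp only; omega⟩)
  have hover : ∀ p q, IsOverArc D.ltC p q →
      ((D.pos x.e < D.pos p ∧ D.pos p < D.pos x.t) ∨
        (D.pos x.t < D.pos p ∧ D.pos p < D.pos x.e)) ∨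
      ((D.pos x.e < D.pos q ∧ D.pos q < D.pos x.t) ∨
        (D.pos x.t < D.pos q ∧ D.pos q < D.pos x.e)) → False := by
    intro p q hpq hpos
    rcases over_pair x.arc hpq with ⟨e1, e2⟩ | h1
    · rw [← e1, ← e2] at hpos; omega
    by_cases hin : (D.pos p < D.pos x.t ∧ D.pos x.t < D.pos q) ∨
        (D.pos q < D.pos x.t ∧ D.pos x.t < D.pos p)
    · refine hstk ⟨p, q, x.t, hpq, x.ter, (btw_iff (over_left hpq) (over_right hpq) x.t_up).2 hin⟩
        ⟨rfl, ?_⟩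
      simp only
      omega
    · obtain ⟨z, rfl, rfl⟩ := h.exists_crossing hpq
      have := z.btw_pos
      have iz := isOverArc_iff.1 z.arc
      have h2 : D.pos z.s ≠ D.pos x.t := pos_ne z.s_up x.t_up fun e =>
        over_not_terminal z.arc (e ▸ x.ter)
      have h3 : D.pos z.e ≠ D.pos x.t := pos_ne z.e_up x.t_up fun e => by
        rw [e] at iz; omega
      exact hterm z.t z.ter (by omega)
  refine h.no_T (isArc_iff.2 ⟨hd1, hd2⟩) x.ter
    (adjacent_of_pos x.e_up x.t_up fun p hp hpos => ?_) (by omega)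
  by_cases hpt : D.IsTerminal p
  · exact hterm p hpt hpos
  · obtain ⟨q, hq | hq⟩ := exists_over hp hpt
    · exact hover p q hq (.inl hpos)
    · exact hover q p hq (.inr hpos)

/-- The crossing system of a simplified diagram admits no removals. -/
theorem Simplified.normal (h : D.Simplified) : D.crossings.Normal := by
  rintro S (⟨x, y, hxy, -⟩ | ⟨x, hx, -⟩)
  · exact h.not_cancels x y hxy
  · exact h.not_unwinds x hx

end VCD

/-! ### Relabellings, `T`-moves and block permutations on crossing systems -/

/-- The labels decide which crossings are comparable. A monotone map that keeps labels therefore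
also reflects both orders, and it is injective. -/
theorem CrossingSystem.exists_emb {n : ℕ} {A B : CrossingSystem n} (F : B.X → A.X)
    (lev : ∀ x, A.lev (F x) = B.lev x) (col : ∀ x, A.col (F x) = B.col x)
    (up : ∀ x, A.up (F x) ↔ B.up x) (cur : ∀ x y, B.cur x y → A.cur (F x) (F y))
    (stk : ∀ x y, B.stk x y → A.stk (F x) (F y)) : ∃ f : Emb B A, f.f = F := by
  have hcur : ∀ x y, A.cur (F x) (F y) → B.cur x y := by
    intro x y h
    have h1 := (A.cur_chains _ _).1 (.inr (.inl h))
    rw [col, col] at h1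
    rcases (B.cur_chains _ _).2 h1 with rfl | h2 | h2
    · exact absurd h (A.cur_irrefl _)
    · exact h2
    · exact absurd (A.cur_trans _ _ _ h (cur _ _ h2)) (A.cur_irrefl _)
  have hstk : ∀ x y, A.stk (F x) (F y) → B.stk x y := by
    intro x y h
    have h1 := (A.stk_chains _ _).1 (.inr (.inl h))
    rw [lev, lev] at h1
    rcases (B.stk_chains _ _).2 h1 with rfl | h2 | h2
    · exact absurd h (A.stk_irrefl _)
    · exact h2
    · exact absurd (A.stk_trans _ _ _ h (stk _ _ h2)) (A.stk_irrefl _)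
  refine ⟨⟨F, fun x y h => ?_, lev, col, up, fun x y => ⟨hcur x y, cur x y⟩,
    fun x y => ⟨hstk x y, stk x y⟩⟩, rfl⟩
  rcases (B.cur_chains x y).2 (by rw [← col, h, col]) with h' | h' | h'
  · exact h'
  · exact absurd (h ▸ cur _ _ h') (A.cur_irrefl _)
  · exact absurd (h ▸ cur _ _ h') (A.cur_irrefl _)

namespace VCD

open CrossingSystem

variable {n : ℕ} {D E : VCD n}

theorem btw_map {f : E.P → D.P} (hP : ∀ x y, D.ltP (f x) (f y) ↔ E.ltP x y) {a b c : E.P} :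
    D.Btw (f a) (f b) (f c) ↔ E.Btw a b c := by
  simp only [Btw, hP]

/-- A map that preserves all the structure, and maps terminal points and over arcs to terminal
points and over arcs, embeds the crossing systems. -/
theorem iso_of_map (f : E.P → D.P) (hP : ∀ x y, D.ltP (f x) (f y) ↔ E.ltP x y)
    (hC : ∀ x y, D.ltC (f x) (f y) ↔ E.ltC x y)
    (ht : ∀ x, E.IsTerminal x ↔ D.IsTerminal (f x))
    (ho : ∀ x y, IsOverArc E.ltC x y ↔ IsOverArc D.ltC (f x) (f y))
    (hsurj : ∀ w : D.Crossing, ∃ s e t, f s = w.s ∧ f e = w.e ∧ f t = w.t) :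
    Iso D.crossings E.crossings := by
  have hcrv : ∀ x, crv (f x) = crv x := by
    refine crv_unique (fun x => crv (f x)) (fun x y h => ?_) fun s t hs ht' h => ?_
    · exact (ltC_iff.1 ((hC x y).2 h)).1
    · exact crv_lt ((ht s).1 hs) ((ht t).1 ht') ((hP s t).2 h)
  let F : E.Crossing → D.Crossing := fun x =>
    ⟨f x.s, f x.e, f x.t, (ho _ _).1 x.arc, (ht _).1 x.ter, (btw_map hP).2 x.btw⟩
  obtain ⟨g, hg⟩ := exists_emb (A := D.crossings) (B := E.crossings) F
    (fun x => hcrv _) (fun x => hcrv _) (fun x => hP _ _)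
    (fun x y (h : x.Before y) => by
      show (F x).Before (F y)
      simp only [Crossing.Before, F, hP, hC]
      rcases h with h | h
      · exact .inl h
      · exact .inr ⟨congrArg f h.1, h.2⟩)
    (fun x y (h : x.Inside y) => ⟨congrArg f h.1, (btw_map hP).2 h.2⟩)
  refine ⟨g, fun w => ?_⟩
  rw [hg]
  obtain ⟨s, e, t, h1, h2, h3⟩ := hsurj w
  have harc := w.arc
  have hter := w.ter
  have hbtw := w.btw
  rw [← h1, ← h2] at harc
  rw [← h3] at hter
  rw [← h1, ← h2, ← h3] at hbtw
  exact ⟨⟨s, e, t, (ho _ _).2 harc, (ht _).2 hter, (btw_map hP).1 hbtw⟩, Crossing.ext h1 h2 h3⟩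

theorem over_of_equiv (f : D.P ≃ E.P) (hC : ∀ x y, E.ltC (f x) (f y) ↔ D.ltC x y) (x y : D.P) :
    E.idx (f x) = D.idx x ∧ (E.IsTerminal (f x) ↔ D.IsTerminal x) ∧
      (IsOverArc E.ltC (f x) (f y) ↔ IsOverArc D.ltC x y) := by
  have hdel : E.Deletion ∅ D.ltC f := ⟨f.injective, by rw [f.range_eq_univ, Set.compl_empty], hC⟩
  have h1 := hdel.idx_eq x
  simp only [Set.mem_empty_iff_false, false_and, Set.ofPred_false, Set.ncard_empty] at h1
  have h2 : curveIndex E.ltC (f x) = curveIndex D.ltC x := h1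
  refine ⟨h1, ?_, ?_⟩
  · simp only [IsTerminal, f.surjective.forall, hC]
  · simp only [IsOverArc, IsArc, f.surjective.forall, hC, h2]

theorem Relabelled.eqv (h : D.Relabelled E) : D.crossings.Eqv E.crossings := by
  obtain ⟨f, hP, hC⟩ := h
  have h := over_of_equiv f hC
  exact (iso_of_map f hP hC (fun x => (h x x).2.1.symm) (fun x y => (h x y).2.2.symm) fun w =>
    ⟨_, _, _, f.apply_symm_apply _, f.apply_symm_apply _, f.apply_symm_apply _⟩).symm.eqv

/-- The new endpoint `a` takes over the role of `b`, and being adjacent to it has the same arcs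
above. The one exception is an over arc that ends at `a` and encloses `b`: its crossing over `b` is
lost, and this crossing unwinds. -/
theorem TMove.eqv (h : D.TMove E) : D.crossings.Eqv E.crossings := by
  obtain ⟨a, b, hab, hb, hadj, f, hinj, hr, hP, hC⟩ := h
  have hdel : D.Deletion {b} E.ltC f := ⟨hinj, hr, hC⟩
  have hab' := isArc_iff.1 hab
  obtain ⟨a, rfl⟩ : ∃ a', f a' = a := hdel.exists_eq (by
    rintro rfl; omega)
  have hne : ∀ x, f x ≠ b := fun x => hdel.notMem x
  have hidx : ∀ x, D.idx (f x) = E.idx x := hdel.T_idx hb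
  have hup : ∀ x, f x ∈ D.base ↔ x ∈ E.base := fun x => by rw [base_iff_idx, hidx, base_iff_idx]
  have hover := hdel.T_over hb
  have hterm : ∀ x, E.IsTerminal x ↔ D.IsTerminal (f x) ∨ x = a := by
    intro x
    constructor
    · intro hx
      by_contra hn
      rw [not_or] at hn
      obtain ⟨y, hy⟩ := exists_isArc_right hn.1
      by_cases hyb : y = b
      · subst hyb
        rw [isArc_iff] at hy
        exact hn.2 (hinj (eq_of_idx (by rw [hab'.1, hy.1]) (by omega)))
      · obtain ⟨y, rfl⟩ := hdel.exists_eq hyb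
        exact hx y ((hC _ _).1 hy.1)
    · rintro (hx | rfl) y hy
      · exact hx _ ((hC _ _).2 hy)
      · rw [← hC, ltC_iff] at hy
        have := terminal_idx hb (x := f y) (by rw [← hy.1, hab'.1])
        exact hne y (eq_of_idx (by rw [← hy.1, hab'.1]) (by omega))
  have hbup := terminal_not_base hb
  have haup : f a ∉ D.base := by
    rw [hup]; exact terminal_not_base ((hterm a).2 (.inr rfl))
  have hfin : ∀ x, E.IsTerminal x → (D.IsTerminal (f x) ∧ fin (f x) = f x) ∨
      (x = a ∧ fin (f x) = b) := by
    intro x hx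
    rcases (hterm x).1 hx with h | rfl
    · exact .inl ⟨h, fin_of_terminal h⟩
    · exact .inr ⟨rfl, by
        rw [← fin_of_terminal (D := D) hb, fin_eq_iff]
        exact .inr (.inl hab.1)⟩
  -- No other point separates `f t` from the end of its curve in `D`; the two differ only if `t =
  -- a`, and then they are adjacent.
  have hside : ∀ z t, z ∉ E.base → E.IsTerminal t → z ≠ t →
      (D.pos (f z) < D.pos (fin (f t)) ↔ D.pos (f z) < D.pos (f t)) ∧
      (D.pos (fin (f t)) < D.pos (f z) ↔ D.pos (f t) < D.pos (f z)) := by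
    intro z t hz ht hzt
    have hz' := mt (hup z).1 hz
    rcases hfin t ht with ⟨-, h⟩ | ⟨rfl, h⟩ <;> rw [h]
    · exact ⟨.rfl, .rfl⟩
    · have h1 := pos_ne hz' hbup (hne z)
      have h2 := pos_ne hz' haup (hinj.ne hzt)
      have h3 := adjacent_pos haup hbup hadj hz'
      omega
  have hcrv : ∀ x, crv (f x) = crv x := by
    refine crv_unique (fun x => crv (f x)) (fun x y h => ?_) fun s t hs ht h => ?_
    · exact (ltC_iff.1 ((hC x y).2 h)).1
    · show crv (f s) < crv (f t)
      rw [← crv_fin (f s), ← crv_fin (f t), crv_lt_iff (fin_terminal _) (fin_terminal _)]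
      have hst : s ≠ t := by rintro rfl; exact E.ltP_irrefl _ h
      have h1 := (hside s t (terminal_not_base hs) ht hst).1.2 (pos_lt ((hP _ _).2 h))
      rcases hfin t ht with ⟨-, h2⟩ | ⟨rfl, h2⟩
      · rw [h2] at h1 ⊢
        exact (hside t s (terminal_not_base ht) hs hst.symm).2.2 h1
      · rcases hfin s hs with ⟨-, h3⟩ | ⟨rfl, h3⟩
        · rw [h3]; exact h1
        · exact absurd rfl hst
  let F : E.Crossing → D.Crossing := fun x =>
    ⟨f x.s, f x.e, fin (f x.t), (hover _ _).1 x.arc, fin_terminal _, by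
      have hs := mt (hup x.s).1 x.s_up
      have he := mt (hup x.e).1 x.e_up
      have ht := mt (hup x.t).1 x.t_up
      have hb := x.btw_pos
      have h1 := (hside x.s x.t x.s_up x.ter (by intro h; rw [h] at hb; omega))
      have h2 := (hside x.e x.t x.e_up x.ter (by intro h; rw [h] at hb; omega))
      have h3 := (btw_iff hs he ht).1 ((btw_map hP).2 x.btw)
      rw [btw_iff hs he (terminal_not_base (fin_terminal _))]
      omega⟩
  have hst : ∀ x : E.Crossing, x.s ≠ x.t := fun x h => over_not_terminal x.arc (h ▸ x.ter)
  obtain ⟨g, hg⟩ := exists_emb (A := D.crossings) (B := E.crossings) F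
    (fun x => by
      show crv (fin (f x.t)) = crv x.t
      rw [crv_fin, hcrv]) (fun x => hcrv _)
    (fun x => by
      show D.ltP (f x.s) (fin (f x.t)) ↔ E.ltP x.s x.t
      rw [ltP_iff (F x).s_up (F x).t_up, (hside x.s x.t x.s_up x.ter (hst x)).1, ← hP,
        ltP_iff (F x).s_up (mt (hup x.t).1 x.t_up)])
    (fun x y (h : x.Before y) => by
      show (F x).Before (F y)
      rw [Crossing.before_iff]
      rcases h with h | ⟨h, h'⟩
      · exact .inl ((hC _ _).2 h)
      · refine .inr ⟨congrArg f h, ?_⟩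
        have h1 : ∀ {u v : E.P}, E.IsTerminal u → E.IsTerminal v → E.ltP u v →
            D.pos (fin (f u)) < D.pos (fin (f v)) := fun hu hv huv => by
          rw [← crv_lt_iff (fin_terminal _) (fin_terminal _), crv_fin, crv_fin, hcrv, hcrv]
          exact crv_lt hu hv huv
        have h2 := hside x.s x.t x.s_up x.ter (hst x)
        rcases h' with ⟨h3, h4⟩ | ⟨h3, h4⟩
        · exact .inl ⟨h2.1.2 (pos_lt ((hP _ _).2 h3)), h1 x.ter y.ter h4⟩
        · exact .inr ⟨h2.2.2 (pos_lt ((hP _ _).2 h3)), h1 y.ter x.ter h4⟩)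
    (fun x y (h : x.Inside y) => ⟨congrArg (fun t => fin (f t)) h.1, (btw_map hP).2 h.2⟩)
  have hrange : ∀ w : D.Crossing, w ∈ Set.range g.f ↔ ¬ (w.e = f a ∧ w.t = b) := by
    intro w
    rw [hg]
    constructor
    · rintro ⟨x, rfl⟩ ⟨h1, h2⟩
      have h1 : x.e = a := hinj h1
      have h2 : fin (f x.t) = b := h2
      have h3 : x.t = x.e := by
        refine terminal_ext x.ter ?_ ?_
        · rw [h1, hterm]; exact .inr rfl
        · rw [← hcrv, ← hcrv, h1, ← crv_fin, h2, hab'.1]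
      have := x.btw_pos
      rw [h3] at this
      omega
    · intro hw
      have iw := isOverArc_iff.1 w.arc
      have pw := w.btw_pos
      have hsb : w.s ≠ b := fun h => over_not_terminal w.arc (h ▸ hb)
      have hsa : w.s ≠ f a := by
        intro h
        have : w.e = b := eq_of_idx (by rw [← iw.1, h, hab'.1]) (by rw [h] at iw; omega)
        have h3 := adjacent_pos haup hbup hadj w.t_up
        rw [h, this] at pw
        omega
      have heb : w.e ≠ b := by
        intro h
        exact hsa (eq_of_idx (by rw [iw.1, h, hab'.1]) (by rw [h] at iw; omega))
      obtain ⟨s, hs⟩ := hdel.exists_eq hsb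
      obtain ⟨e, he⟩ := hdel.exists_eq heb
      have harc := w.arc
      rw [← hs, ← he] at harc
      obtain ⟨t, ht, htw⟩ : ∃ t, E.IsTerminal t ∧ fin (f t) = w.t := by
        by_cases htb : w.t = b
        · refine ⟨a, (hterm a).2 (.inr rfl), ?_⟩
          rw [htb]
          rcases hfin a ((hterm a).2 (.inr rfl)) with ⟨h, -⟩ | h
          · exact absurd hab.1 (h _)
          · exact h.2
        · obtain ⟨t, ht⟩ := hdel.exists_eq htb
          refine ⟨t, (hterm t).2 (.inl (ht ▸ w.ter)), ?_⟩
          rw [ht, fin_of_terminal w.ter]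
      have harc' := (hover _ _).2 harc
      have het : e ≠ t := by
        rintro rfl
        rcases hfin e ht with ⟨-, h⟩ | ⟨h1, h2⟩
        · rw [h] at htw
          rw [← he, ← htw] at pw
          omega
        · exact hw ⟨by rw [← he, h1], by rw [← htw, h2]⟩
      have hs_up := over_left harc'
      have he_up := over_right harc'
      have h1 := hside s t hs_up ht (fun h => over_not_terminal harc' (h ▸ ht))
      have h2 := hside e t he_up ht het
      refine ⟨⟨s, e, t, harc', ht, (btw_map hP).1 ?_⟩, Crossing.ext hs he htw⟩
      rw [btw_iff (mt (hup s).1 hs_up) (mt (hup e).1 he_up)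
        (mt (hup t).1 (terminal_not_base ht))]
      rw [← hs, ← he, ← htw] at pw
      omega
  by_cases hex : ∃ w : D.Crossing, w.e = f a ∧ w.t = b
  · obtain ⟨w, hw1, hw2⟩ := hex
    have iw := isOverArc_iff.1 w.arc
    have pw := w.btw_pos
    rw [hw1] at iw
    refine Step.eqv ⟨g, {w}, .inr ⟨w, ⟨?_, fun (z : D.Crossing) (hz : w.Before z) => ?_,
      fun (z : D.Crossing) (hz : z.Inside w) => ?_⟩, rfl⟩, Set.ext fun (z : D.Crossing) => ?_⟩
    · show crv w.s = crv w.t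
      rw [hw2, iw.1, hab'.1]
    · rw [Crossing.before_iff] at hz
      have iz := isOverArc_iff.1 z.arc
      rcases hz with hz | ⟨hz, hz'⟩
      · rw [ltC_iff] at hz
        have : crv z.s = crv b := by rw [← hz.1, iw.1, hab'.1]
        have h1 := terminal_idx hb this
        have : z.s = b := eq_of_idx this (by omega)
        exact over_not_terminal z.arc (this ▸ hb)
      · have h3 := adjacent_pos haup hbup hadj z.t_up
        have pz := z.btw_pos
        rw [← Crossing.e_eq hz, ← hz, hw1] at pz
        rw [hw1] at pw
        rw [hw2] at pw hz'
        omega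
    · rw [Crossing.inside_iff] at hz
      have pz := z.btw_pos
      have h3 := adjacent_pos haup hbup hadj z.s_up
      have h4 := adjacent_pos haup hbup hadj z.e_up
      rcases over_pair w.arc z.arc with ⟨h1, -⟩ | h1
      · rw [← h1] at hz; omega
      · rw [hz.1] at pz
        rw [hw1] at hz h1 pw
        rw [hw2] at pz pw
        obtain ⟨-, hz⟩ := hz
        rcases pw with pw | pw <;> rcases pz with pz | pz <;> omega
    · refine (hrange z).trans (not_congr (Iff.trans ?_ Set.mem_singleton_iff.symm))
      constructor
      · rintro ⟨h1, h2⟩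
        have iz := isOverArc_iff.1 z.arc
        rw [h1] at iz
        exact Crossing.ext' (eq_of_idx (by rw [iz.1, iw.1]) (by omega)) (by rw [h2, hw2])
      · rintro rfl
        exact ⟨hw1, hw2⟩
  · refine Iso.eqv ⟨g, fun w => ?_⟩
    exact (hrange w).2 fun h => hex ⟨w, h⟩

/-- Permuting the blocks of a diagram permutes the marked points of its crossing system. -/
theorem BlockPermuted.iso {π : Equiv.Perm (Fin n)} (h : BlockPermuted π D E) :
    Iso (D.crossings.relabel π) E.crossings := by
  obtain ⟨block, f, hmono, hblk, hblk_over, hC, -, hU⟩ := h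
  have hf := over_of_equiv f hC
  have hup : ∀ x, f x ∈ E.base ↔ x ∈ D.base := fun x => by
    rw [base_iff_idx, (hf x x).1, base_iff_idx]
  have hblk' : ∀ t, D.IsTerminal t → block t = crv t := fun t ht =>
    hblk _ t (isTerminalAt_iff.2 ⟨ht, rfl⟩)
  have hP : ∀ x y, x ∉ D.base → y ∉ D.base → block x = block y →
      (E.ltP (f x) (f y) ↔ D.ltP x y) := by
    intro x y hx hy hxy
    rw [hU x y hx hy, hxy]
    simp
  have hcrv : ∀ x, crv (f x) = π (crv x) := by
    intro x
    have := crv_unique (D := E) (fun y => π (crv (f.symm y))) (fun y z h => ?_)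
      (fun s t hs ht h => ?_) (f x)
    · rw [← this, f.symm_apply_apply]
    · rw [← f.apply_symm_apply y, ← f.apply_symm_apply z, hC, ltC_iff] at h
      show π _ = π _
      rw [h.1]
    · rw [← f.apply_symm_apply s] at hs h
      rw [← f.apply_symm_apply t] at ht h
      rw [(hf _ (f.symm s)).2.1] at hs ht
      rw [hU _ _ (terminal_not_base hs) (terminal_not_base ht), hblk' _ hs, hblk' _ ht] at h
      rcases h with h | ⟨h1, h2⟩
      · exact h
      · rw [terminal_ext hs ht h1] at h2
        exact absurd h2 (D.ltP_irrefl _)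
  -- A crossing lives in one block, since blocks are intervals and contain over arcs entirely.
  -- Inside a block nothing changes.
  have hbx : ∀ x : D.Crossing, block x.s = block x.e ∧ block x.s = block x.t := by
    intro x
    have h1 := hblk_over _ _ x.arc
    refine ⟨h1, ?_⟩
    rcases x.btw with h | h
    · have h2 := hmono _ _ x.s_up x.t_up h.1
      have h3 := hmono _ _ x.t_up x.e_up h.2
      rw [← h1] at h3
      exact le_antisymm h2 h3
    · have h2 := hmono _ _ x.e_up x.t_up h.1
      have h3 := hmono _ _ x.t_up x.s_up h.2
      rw [← h1] at h2
      exact le_antisymm h2 h3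
  have hbtw : ∀ x y z, x ∉ D.base → y ∉ D.base → z ∉ D.base → block x = block y →
      block x = block z → (E.Btw (f x) (f y) (f z) ↔ D.Btw x y z) := by
    intro x y z hx hy hz h1 h2
    have h3 := h1.symm.trans h2
    rw [Btw, hP x z hx hz h2, hP z y hz hy h3.symm, hP y z hy hz h3, hP z x hz hx h2.symm, Btw]
  let F : D.Crossing → E.Crossing := fun x =>
    ⟨f x.s, f x.e, f x.t, (hf _ _).2.2.2 x.arc, (hf _ x.t).2.1.2 x.ter,
      (hbtw _ _ _ x.s_up x.e_up x.t_up (hbx x).1 (hbx x).2).2 x.btw⟩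
  obtain ⟨g, hg⟩ := exists_emb (A := E.crossings) (B := D.crossings.relabel π) F
    (fun x => hcrv _) (fun x => hcrv _)
    (fun (x : D.Crossing) => hP _ _ x.s_up x.t_up (hbx x).2)
    (fun (x y : D.Crossing) (h : x.Before y) => by
      rcases h with h | ⟨h, h'⟩
      · exact .inl ((hC _ _).2 h)
      · have h1 := (hbx x).2
        have h2 := (hbx y).2
        rw [← h] at h2
        have h3 := h1.symm.trans h2
        refine .inr ⟨congrArg f h, ?_⟩
        simp only [F, hP _ _ x.s_up x.t_up h1, hP _ _ x.t_up y.t_up h3,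
          hP _ _ x.t_up x.s_up h1.symm, hP _ _ y.t_up x.t_up h3.symm]
        exact h')
    (fun (x y : D.Crossing) (h : x.Inside y) => by
      have h1 := (hbx y).2
      rw [← h.1, ← (hbx x).2] at h1
      exact ⟨congrArg f h.1, (hbtw _ _ _ y.s_up y.e_up x.s_up (hbx y).1 h1).2 h.2⟩)
  refine Iso.symm ⟨g, fun (w : E.Crossing) => ?_⟩
  rw [hg]
  obtain ⟨s, e, t, harc, hter, hb⟩ := w
  obtain ⟨s, rfl⟩ := f.surjective s
  obtain ⟨e, rfl⟩ := f.surjective e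
  obtain ⟨t, rfl⟩ := f.surjective t
  have harc' := (hf _ _).2.2.1 harc
  have hter' := (hf _ t).2.1.1 hter
  have hs := over_left harc'
  have he := over_right harc'
  have ht := terminal_not_base hter'
  have h1 := hblk_over _ _ harc'
  -- Conversely, the line of `E` is ordered by blocks first, so whatever lies between two points of
  -- a block belongs to that block.
  have h2 : block s = block t := by
    have hb' := hb
    rw [Btw, hU _ _ hs ht, hU _ _ ht he, hU _ _ he ht, hU _ _ ht hs, ← h1] at hb'
    rcases hb' with ⟨h | h, k | k⟩ | ⟨h | h, k | k⟩
    · exact absurd k h.asymm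
    · exact k.1.symm
    · exact h.1
    · exact h.1
    · exact absurd k h.asymm
    · exact k.1.symm
    · exact h.1
    · exact h.1
  exact ⟨⟨s, e, t, harc', hter', (hbtw _ _ _ hs he ht h1 h2).1 hb⟩, rfl⟩

end VCD

/-! ### `B`-moves at a turn between two over arcs -/

/-- The number `x` lies strictly between `a` and `b`. -/
abbrev NatBtw (a b x : ℕ) : Prop := (a < x ∧ x < b) ∨ (b < x ∧ x < a)

section Arith

variable {a b c d t z p q : ℕ}

/-- In this section `a`, `b`, `c`, `d` stand for the positions of a curve going over from `a` to
`b`, turning to the adjacent `c`, and going over to `d`; `p`, `q` are the ends of another over arc.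
Crossing `t` again after the turn means coming back. -/
theorem turn_dir (h1 : NatBtw a b t) (h2 : NatBtw c d t) (h3 : ¬ NatBtw b c t) :
    ¬ (a < t ↔ c < t) := by omega

/-- Whatever is passed between `t` and the turn is nearer to `b`, and it is passed again on the way
back to `t`. -/
theorem turn_after (h2 : NatBtw c d t ∨ t = d) (hz : NatBtw a b z)
    (ht : ¬ NatBtw b c t) (hz' : ¬ NatBtw b c z) (n1 : t ≠ c) (n2 : z ≠ c)
    (h : (a < t ∧ t < z) ∨ (t < a ∧ z < t)) :
    NatBtw c d z ∧ (z - b) + (b - z) < (t - b) + (b - t) := by omega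

theorem turn_before (h1 : NatBtw a b t) (h2 : NatBtw c d t ∨ t = d)
    (ht : ¬ NatBtw b c t) (hz' : ¬ NatBtw b c z) (n1 : t ≠ c) (n2 : z ≠ b)
    (h : (c < z ∧ z < t) ∨ (z < c ∧ t < z)) :
    NatBtw a b z ∧ (z - b) + (b - z) < (t - b) + (b - t) := by omega

/-- An arc around `(a, b)` also encloses `c`, which cannot be told from `b`. So it cannot lie inside
`(c, d)`; the other case is symmetric. -/
theorem turn_stack (h1 : NatBtw a b t) (h2 : NatBtw c d t) (hin : NatBtw p q t)
    (hp : ¬ NatBtw b c p) (hq : ¬ NatBtw b c q) (n1 : b ≠ p) (n2 : b ≠ q) (n3 : c ≠ p)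
    (n4 : c ≠ q) (i1 : NatBtw a b p ↔ NatBtw a b q) (i2 : NatBtw c d p ↔ NatBtw c d q) :
    ¬ (NatBtw p q a ∧ NatBtw c d p) ∧ ¬ (NatBtw p q c ∧ NatBtw a b p) := by
  rcases h1 with h1 | h1 <;> rcases h2 with h2 | h2 <;> rcases hin with hin | hin <;> omega

/-- An arc inside `(a, b)` does not enclose `b`, hence not `c`. If it enclosed `d`, it would cross
`(c, d)`. -/
theorem turn_end (h1 : NatBtw a b d) (hin : NatBtw p q d) (hab : NatBtw a b p)
    (hp : ¬ NatBtw b c p) (hq : ¬ NatBtw b c q) (hd : ¬ NatBtw b c d) (n1 : b ≠ p) (n2 : b ≠ q)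
    (n3 : c ≠ p) (n4 : c ≠ q) (n5 : d ≠ c) (i1 : NatBtw a b p ↔ NatBtw a b q)
    (i2 : NatBtw c d p ↔ NatBtw c d q) : False := by
  rcases h1 with h1 | h1 <;> rcases hin with hin | hin <;> omega

/-- Going from `a` to `d` by way of `b` and `c`, a point between `a` and `d` is passed an odd number
of times, and never in the gap. So the joined arc crosses what exactly one of the two pieces
crosses, in the same direction. -/
theorem join_cases (h : NatBtw a d t) (h1 : ¬ NatBtw a b t) (h2 : ¬ NatBtw b c t) (n1 : t ≠ b)
    (n2 : t ≠ c) : NatBtw c d t ∧ (a < t ↔ c < t) := by omega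

theorem join_first (h1 : NatBtw a b t) (h2 : ¬ NatBtw c d t) (h3 : ¬ NatBtw b c t) (n1 : t ≠ b)
    (n2 : t ≠ c) (n3 : t ≠ d) : NatBtw a d t := by omega

theorem join_second (h1 : NatBtw c d t) (h2 : ¬ NatBtw a b t) (h3 : ¬ NatBtw b c t) (n1 : t ≠ b)
    (n2 : t ≠ c) (n3 : t ≠ a) : NatBtw a d t := by omega

theorem join_not_shared (h : NatBtw a d t) (h1 : NatBtw a b t) (h2 : ¬ NatBtw b c t)
    (n2 : t ≠ c) : ¬ NatBtw c d t := by omega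

theorem join_order (h : NatBtw a b z) (h1 : ¬ NatBtw a b t)
    (h2 : (a < t ∧ t < z) ∨ (t < a ∧ z < t)) : False := by omega

theorem join_inside (h : NatBtw p q a) (hp : ¬ NatBtw b c p) (hq : ¬ NatBtw b c q) (n1 : b ≠ p)
    (n2 : b ≠ q) (n3 : c ≠ p) (n4 : c ≠ q) (i : NatBtw p q a ↔ NatBtw p q b) :
    NatBtw p q c := by omega

theorem inside_join_first (h : NatBtw a d p) (ht : NatBtw a d t) (h1 : NatBtw a b t)
    (hin : NatBtw p q t) (h2 : ¬ NatBtw b c t) (hp : ¬ NatBtw b c p) (n1 : b ≠ p) (n3 : c ≠ p)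
    (n2 : t ≠ c) (i1 : NatBtw a b p ↔ NatBtw a b q) (i2 : NatBtw c d p ↔ NatBtw c d q) :
    NatBtw a b p := by
  by_contra h3
  have h4 := (join_cases h h3 hp n1.symm n3.symm).1
  have h5 := i2.1 h4
  have h6 := join_not_shared ht h1 h2 n2
  omega

theorem inside_join_second (h : NatBtw a d p) (h1 : ¬ NatBtw a b t)
    (hin : NatBtw p q t) (hp : ¬ NatBtw b c p) (n1 : b ≠ p) (n3 : c ≠ p)
    (i1 : NatBtw a b p ↔ NatBtw a b q) : NatBtw c d p := by
  by_cases h3 : NatBtw a b p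
  · have := i1.1 h3
    omega
  · exact (join_cases h h3 hp n1.symm n3.symm).1

end Arith

namespace CrossingSystem

theorem step_restrict {n : ℕ} {A : CrossingSystem n} {K K' : Set A.X}
    {S : Set (A.restrict K).X} (hS : (A.restrict K).Redex S) (hsub : K' ⊆ K)
    (hK : ∀ z : (A.restrict K).X, (A.incl K).f z ∈ K' ↔ z ∉ S) :
    Step (A.restrict K) (A.restrict K') := by
  obtain ⟨k, hk⟩ := (A.incl K').exists_lift (A.incl K) (by rw [range_incl, range_incl]; exact hsub)
  refine ⟨k, S, hS, Set.ext fun z => ?_⟩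
  refine Iff.trans ?_ ((Set.ext_iff.1 (range_incl A K') _).trans (hK z))
  constructor
  · rintro ⟨y, rfl⟩
    exact ⟨y, (hk y).symm⟩
  · rintro ⟨y, hy⟩
    exact ⟨y, (A.incl K).inj (by rw [hk, hy])⟩

end CrossingSystem

namespace VCD

open CrossingSystem

variable {n : ℕ} {D E : VCD n} {a b c d : D.P}

/-- The curve turns around along the arc `(b, c)` between two over arcs. -/
structure Turn (D : VCD n) (a b c d : D.P) : Prop where
  ab : IsOverArc D.ltC a b
  bc : IsArc D.ltC b c
  cd : IsOverArc D.ltC c d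
  adj : D.Adjacent b c

/-- The curve goes back under `t` after the turn, or ends there. -/
def Shared (D : VCD n) (a b c d t : D.P) : Prop :=
  NatBtw (D.pos a) (D.pos b) (D.pos t) ∧ (NatBtw (D.pos c) (D.pos d) (D.pos t) ∨ t = d)

/-- The distance between the positions of two points. -/
noncomputable def dist (D : VCD n) (b t : D.P) : ℕ := (D.pos t - D.pos b) + (D.pos b - D.pos t)

/-- The crossings left after those next to the turn have been removed up to distance `m`. -/
def keep (D : VCD n) (a b c d : D.P) (m : ℕ) : Set D.crossings.X :=
  {w : D.Crossing | ¬ ((w.s = a ∨ w.s = c) ∧ D.Shared a b c d w.t ∧ D.dist b w.t < m)}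

theorem mem_keep {m : ℕ} {w : D.Crossing} : w ∈ D.keep a b c d m ↔
    ¬ ((w.s = a ∨ w.s = c) ∧ D.Shared a b c d w.t ∧ D.dist b w.t < m) := Iff.rfl

namespace Turn

theorem b_up (T : D.Turn a b c d) : b ∉ D.base := over_right T.ab

theorem c_up (T : D.Turn a b c d) : c ∉ D.base := over_left T.cd

theorem idx_eq (T : D.Turn a b c d) : crv a = crv b ∧ crv b = crv c ∧ crv c = crv d ∧ D.idx b = D.idx a + 1 ∧
    D.idx c = D.idx a + 2 ∧ D.idx d = D.idx a + 3 ∧ D.idx a % 2 = 1 := by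
  have h1 := isOverArc_iff.1 T.ab
  have h2 := isArc_iff.1 T.bc
  have h3 := isOverArc_iff.1 T.cd
  exact ⟨h1.1, h2.1, h3.1, by omega, by omega, by omega, by omega⟩

theorem not_btw (T : D.Turn a b c d) {t : D.P} (ht : t ∉ D.base) : ¬ NatBtw (D.pos b) (D.pos c) (D.pos t) :=
  not_or.2 (adjacent_pos T.b_up T.c_up T.adj ht)

theorem pos_ne_b (T : D.Turn a b c d) {t : D.P} (ht : D.IsTerminal t) : D.pos t ≠ D.pos b :=
  pos_ne (terminal_not_base ht) T.b_up (by rintro rfl; exact ht _ T.bc.1)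

theorem pos_ne_c (T : D.Turn a b c d) {t : D.P} (ht : D.IsTerminal t) : D.pos t ≠ D.pos c :=
  pos_ne (terminal_not_base ht) T.c_up (by rintro rfl; exact ht _ T.cd.1.1)

theorem pos_ne_a (T : D.Turn a b c d) {t : D.P} (ht : D.IsTerminal t) : D.pos t ≠ D.pos a :=
  pos_ne (terminal_not_base ht) (over_left T.ab) (by rintro rfl; exact ht _ T.ab.1.1)

/-- After the crossing `(a, b, t)` the curve only crosses shared points closer to the turn. -/
theorem after (T : D.Turn a b c d) {x z : D.Crossing} (hx : x.s = a) (hs : D.Shared a b c d x.t) (h : x.Before z) :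
    (z.s = a ∧ D.Shared a b c d z.t ∧ D.dist b z.t < D.dist b x.t) ∨ z.s = c ∨
      D.ltC c z.s := by
  have hi := T.idx_eq
  have iz := isOverArc_iff.1 z.arc
  rw [Crossing.before_iff, hx, ltC_iff] at h
  rcases h with h | ⟨h, h'⟩
  · right
    rw [ltC_iff]
    by_cases hz : D.idx z.s = D.idx c
    · exact .inl (eq_of_idx (by rw [← h.1, hi.1, hi.2.1]) hz)
    · exact .inr ⟨by rw [← h.1, hi.1, hi.2.1], by omega⟩
  · left
    have e : z.e = b := eq_of_idx (by rw [← iz.1, ← h, hi.1]) (by rw [← h] at iz; omega)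
    have pz : NatBtw _ _ _ := z.btw_pos
    rw [← h, e] at pz
    have := turn_after (hs.2.imp_right fun h => congrArg _ h) pz (T.not_btw x.t_up)
      (T.not_btw z.t_up) (T.pos_ne_c x.ter) (T.pos_ne_c z.ter) h'
    exact ⟨h.symm, ⟨pz, .inl this.1⟩, this.2⟩

theorem before (T : D.Turn a b c d) {t : D.P} {z : D.Crossing} (ht : D.IsTerminal t) (hs : D.Shared a b c d t)
    (hz : z.s = c)
    (h : (D.pos c < D.pos z.t ∧ D.pos z.t < D.pos t) ∨
      (D.pos z.t < D.pos c ∧ D.pos t < D.pos z.t)) :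
    D.Shared a b c d z.t ∧ D.dist b z.t < D.dist b t := by
  have hi := T.idx_eq
  have iz := isOverArc_iff.1 z.arc
  have e : z.e = d := eq_of_idx (by rw [← iz.1, hz, hi.2.2.1]) (by rw [hz] at iz; omega)
  have pz : NatBtw _ _ _ := z.btw_pos
  rw [hz, e] at pz
  have := turn_before hs.1 (hs.2.imp_right fun h => congrArg _ h)
    (T.not_btw (terminal_not_base ht)) (T.not_btw z.t_up) (T.pos_ne_c ht) (T.pos_ne_b z.ter) h
  exact ⟨⟨this.1, .inl pz⟩, this.2⟩

/-- All shared points lie on the same side of `b`, namely that of `a`, so the distance determines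
them. -/
theorem unique {t t' : D.P} (ht : D.IsTerminal t) (ht' : D.IsTerminal t')
    (hs : D.Shared a b c d t) (hs' : D.Shared a b c d t') (h : D.dist b t = D.dist b t') :
    t = t' := by
  refine eq_of_pos (terminal_not_base ht) (terminal_not_base ht') ?_
  have h1 := hs.1
  have h2 := hs'.1
  simp only [dist] at h
  omega

/-- Removal goes outwards from the turn. Once the nearer shared points are dealt with, the two
crossings at distance `m` have become consecutive on the curve and neighbours in the stack, so they
cancel. If the shared point is `d`, where the curve ends, there is only the crossing of `(a, b)`,
and it unwinds. -/
theorem eqv_succ (T : D.Turn a b c d) (m : ℕ) : Eqv (D.crossings.restrict (D.keep a b c d m))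
    (D.crossings.restrict (D.keep a b c d (m + 1))) := by
  have hi := T.idx_eq
  have hac : a ≠ c := by rintro rfl; omega
  by_cases hex : ∃ t, D.IsTerminal t ∧ D.Shared a b c d t ∧ D.dist b t = m
  swap
  · have : D.keep a b c d m = D.keep a b c d (m + 1) := by
      refine Set.ext fun (w : D.Crossing) => not_congr (and_congr_right fun _ => and_congr_right fun h => ?_)
      have : D.dist b w.t ≠ m := fun h' => hex ⟨_, w.ter, h, h'⟩
      omega
    rw [this]
    exact (Iso.refl _).eqv
  obtain ⟨t, ht, hs, hm⟩ := hex
  have htu := terminal_not_base ht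
  have hsub : D.keep a b c d (m + 1) ⊆ D.keep a b c d m := by
    intro (w : D.Crossing) hw h
    exact hw ⟨h.1, h.2.1, by omega⟩
  have hkeep : ∀ w : D.Crossing, w ∈ D.keep a b c d m →
      (w ∈ D.keep a b c d (m + 1) ↔ ¬ ((w.s = a ∨ w.s = c) ∧ w.t = t)) := by
    intro w hw
    rw [mem_keep] at hw ⊢
    refine not_congr (and_congr_right fun h => ?_)
    constructor
    · rintro ⟨h1, h2⟩
      have h3 : ¬ D.dist b w.t < m := fun h3 => hw ⟨h, h1, h3⟩
      exact unique w.ter ht h1 hs (by omega)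
    · intro h
      rw [h]
      exact ⟨hs, by omega⟩
  let x : D.Crossing := ⟨a, b, t, T.ab, ht, (btw_iff (over_left T.ab) T.b_up htu).2 hs.1⟩
  have hx : x ∈ D.keep a b c d m := fun h => by
    have h3 : D.dist b t < m := h.2.2
    omega
  rcases hs.2 with hcd | rfl
  · let y : D.Crossing := ⟨c, d, t, T.cd, ht, (btw_iff T.c_up (over_right T.cd) htu).2 hcd⟩
    have hy : y ∈ D.keep a b c d m := fun h => by
      have h3 : D.dist b t < m := h.2.2
      omega
    refine (step_restrict (.inl ⟨⟨x, hx⟩, ⟨y, hy⟩, ⟨?_, rfl, ?_, ?_, ?_⟩, rfl⟩) hsub ?_).eqv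
    · show crv a = crv c
      rw [hi.1, hi.2.1]
    · show ¬ (D.ltP a t ↔ D.ltP c t)
      rw [ltP_iff (over_left T.ab) htu, ltP_iff T.c_up htu]
      exact turn_dir hs.1 hcd (T.not_btw htu)
    · rintro ⟨(z : D.Crossing), hz⟩
      constructor
      · rintro ⟨(h1 : x.Before z), (h2 : z.Before y)⟩
        rcases T.after rfl hs h1 with h | h | h
        · exact hz ⟨.inl h.1, h.2.1, lt_of_lt_of_eq h.2.2 hm⟩
        · rw [Crossing.before_iff] at h2
          rcases h2 with h2 | ⟨-, h2⟩
          · rw [h] at h2; exact D.ltC_irrefl _ h2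
          · rw [h] at h2
            have := T.before ht hs h h2
            exact hz ⟨.inr h, this.1, lt_of_lt_of_eq this.2 hm⟩
        · rw [Crossing.before_iff] at h2
          rcases h2 with h2 | ⟨h2, -⟩
          · exact D.ltC_irrefl _ (D.ltC_trans _ _ _ h h2)
          · rw [h2] at h; exact D.ltC_irrefl _ h
      · rintro ⟨(h1 : y.Before z), (h2 : z.Before x)⟩
        have h3 : y.Before x := D.crossings.cur_trans y z x h1 h2
        rw [Crossing.before_iff, ltC_iff] at h3
        rcases h3 with ⟨-, h3⟩ | ⟨h3, -⟩
        · have h3 : D.idx c < D.idx a := h3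
          omega
        · exact hac h3.symm
    · rintro ⟨(z : D.Crossing), hz⟩
      have key : z.t = t → ¬ (NatBtw (D.pos z.s) (D.pos z.e) (D.pos a) ∧
            NatBtw (D.pos c) (D.pos d) (D.pos z.s)) ∧
          ¬ (NatBtw (D.pos z.s) (D.pos z.e) (D.pos c) ∧
            NatBtw (D.pos a) (D.pos b) (D.pos z.s)) := by
        intro hzt
        have pz : NatBtw _ _ _ := z.btw_pos
        rw [hzt] at pz
        rcases over_pair T.ab z.arc with ⟨h1, h2⟩ | h1
        · rw [← h1]
          omega
        rcases over_pair T.cd z.arc with ⟨h2, h3⟩ | h2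
        · rw [← h2]
          omega
        exact turn_stack hs.1 hcd pz (T.not_btw z.s_up) (T.not_btw z.e_up) h1.2.2.1 h1.2.2.2.1
          h2.1 h2.2.1 h1.2.2.2.2 h2.2.2.2.2
      constructor
      · rintro ⟨(h1 : x.Inside z), (h2 : z.Inside y)⟩
        rw [Crossing.inside_iff] at h1 h2
        exact (key h2.1).1 ⟨h1.2, h2.2⟩
      · rintro ⟨(h1 : y.Inside z), (h2 : z.Inside x)⟩
        rw [Crossing.inside_iff] at h1 h2
        exact (key h2.1).2 ⟨h1.2, h2.2⟩
    · rintro ⟨(z : D.Crossing), hz⟩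
      refine (hkeep z hz).trans (not_congr ?_)
      constructor
      · rintro ⟨h1 | h1, h2⟩
        · exact .inl (Subtype.ext (Crossing.ext' h1 h2))
        · exact .inr (Subtype.ext (Crossing.ext' h1 h2))
      · rintro (h | h)
        · have h : z = x := Subtype.mk.inj h
          exact ⟨.inl (congrArg Crossing.s h), congrArg Crossing.t h⟩
        · have h : z = y := Subtype.mk.inj h
          exact ⟨.inr (congrArg Crossing.s h), congrArg Crossing.t h⟩
  · refine (step_restrict (.inr ⟨⟨x, hx⟩, ⟨?_, ?_, ?_⟩, rfl⟩) hsub ?_).eqv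
    · show crv a = crv t
      rw [hi.1, hi.2.1, hi.2.2.1]
    · rintro ⟨(z : D.Crossing), hz⟩ (h : x.Before z)
      rcases T.after rfl hs h with h | h | h
      · exact hz ⟨.inl h.1, h.2.1, lt_of_lt_of_eq h.2.2 hm⟩
      · have iz := isOverArc_iff.1 z.arc
        have e : z.e = t := eq_of_idx (by rw [← iz.1, h, hi.2.2.1]) (by rw [h] at iz; omega)
        have pz := z.btw_pos
        rw [h, e] at pz
        have := T.before ht hs h (by omega)
        exact hz ⟨.inr h, this.1, lt_of_lt_of_eq this.2 hm⟩
      · have iz := isOverArc_iff.1 z.arc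
        rw [ltC_iff] at h
        have := terminal_idx ht (x := z.s) (by rw [← h.1, hi.2.2.1])
        omega
    · rintro ⟨(z : D.Crossing), hz⟩ (h : z.Inside x)
      rw [Crossing.inside_iff] at h
      have h2 : NatBtw (D.pos a) (D.pos b) (D.pos z.s) := h.2
      have hzt : z.t = t := h.1
      have pz : NatBtw _ _ _ := z.btw_pos
      rw [hzt] at pz
      rcases over_pair T.ab z.arc with ⟨h1, -⟩ | h1
      · rw [← h1] at h2
        omega
      rcases over_pair T.cd z.arc with ⟨-, h3⟩ | h3
      · rw [← h3] at pz
        omega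
      exact turn_end hs.1 pz h2 (T.not_btw z.s_up) (T.not_btw z.e_up) (T.not_btw htu)
        h1.2.2.1 h1.2.2.2.1 h3.1 h3.2.1 (T.pos_ne_c ht) h1.2.2.2.2 h3.2.2.2.2
    · rintro ⟨(z : D.Crossing), hz⟩
      refine (hkeep z hz).trans (not_congr ?_)
      constructor
      · rintro ⟨h1 | h1, h2⟩
        · exact Subtype.ext (Crossing.ext' h1 h2)
        · have iz := isOverArc_iff.1 z.arc
          have e : z.e = t := eq_of_idx (by rw [← iz.1, h1, hi.2.2.1]) (by rw [h1] at iz; omega)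
          have pz := z.btw_pos
          rw [e, h2] at pz
          omega
      · intro h
        have h : z = x := Subtype.mk.inj h
        exact ⟨.inl (congrArg Crossing.s h), congrArg Crossing.t h⟩

theorem eqv_keep (T : D.Turn a b c d) (m : ℕ) : Eqv D.crossings (D.crossings.restrict (D.keep a b c d m)) := by
  induction m with
  | zero =>
    refine (iso_of_emb (Emb.refl _) (D.crossings.incl _) ?_).eqv
    rw [range_incl]
    show Set.range id = _
    rw [Set.range_id, eq_comm, Set.eq_univ_iff_forall]
    rintro w ⟨-, -, h⟩
    omega
  | succ m ih => exact ih.trans (T.eqv_succ m)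

end Turn

end VCD

namespace VCD

open CrossingSystem

variable {n : ℕ} {D E : VCD n}

/-- A `B`-move on a turn between two over arcs: the joined over arc keeps the crossings that are
not shared. -/
theorem Turn.eqv_of_deletion {a b c d : D.P} (T : D.Turn a b c d) {f : E.P → D.P}
    (hdel : D.Deletion {b, c} E.ltC f) (hP : ∀ x y, D.ltP (f x) (f y) ↔ E.ltP x y)
    (hup : ∀ x, x ∉ E.base → f x ∉ D.base)
    (hterm : ∀ x, E.IsTerminal x ↔ D.IsTerminal (f x)) (hcrv : ∀ x, crv (f x) = crv x) :
    D.crossings.Eqv E.crossings := by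
  classical
  have hi := T.idx_eq
  have hover : ∀ x y, IsOverArc E.ltC x y ↔ IsOverArc D.ltC (f x) (f y) ∨ (f x = a ∧ f y = d) := by
    intro x y
    rw [hdel.B_over T.ab.1 T.bc T.cd.1, hi.2.2.2.2.2.2]
    simp only [and_true]
  have hne : ∀ x, f x ≠ b ∧ f x ≠ c := fun x => by
    have := hdel.notMem x
    simpa [not_or] using this
  have hover' : ∀ x : E.Crossing, (f x.s = a ∧ f x.e = d) ∨
      (f x.s ≠ a ∧ IsOverArc D.ltC (f x.s) (f x.e)) := by
    intro x
    rcases (hover _ _).1 x.arc with h | h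
    · refine .inr ⟨fun h' => (hne x.e).1 ?_, h⟩
      have i := isOverArc_iff.1 h
      exact eq_of_idx (by rw [← i.1, h', hi.1]) (by rw [h'] at i; omega)
    · exact .inl h
  have hpos : ∀ x : E.Crossing, NatBtw (D.pos (f x.s)) (D.pos (f x.e)) (D.pos (f x.t)) := fun x =>
    (btw_iff (hup _ x.s_up) (hup _ x.e_up) (hup _ x.t_up)).1 ((btw_map hP).2 x.btw)
  -- A crossing of the joined arc `(a, d)` comes from whichever of the two pieces passes over that
  -- terminal point.
  let F : E.Crossing → D.Crossing := fun x =>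
    if h : f x.s = a then
      if h' : D.Btw a b (f x.t) then ⟨a, b, f x.t, T.ab, (hterm _).1 x.ter, h'⟩
      else ⟨c, d, f x.t, T.cd, (hterm _).1 x.ter, by
        have hp := hpos x
        have ht := (hterm _).1 x.ter
        have htu := terminal_not_base ht
        rw [btw_iff (over_left T.ab) T.b_up htu] at h'
        rw [h, ((hover' x).resolve_right fun h' => h'.1 h).2] at hp
        rw [btw_iff T.c_up (over_right T.cd) htu]
        exact (join_cases hp h' (T.not_btw htu) (T.pos_ne_b ht) (T.pos_ne_c ht)).1⟩
    else ⟨f x.s, f x.e, f x.t, ((hover' x).resolve_left fun h' => h h'.1).2, (hterm _).1 x.ter,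
      (btw_map hP).2 x.btw⟩
  have hF : ∀ x, (F x).t = f x.t ∧
      ((f x.s ≠ a ∧ (F x).s = f x.s ∧ (F x).e = f x.e) ∨
      (f x.s = a ∧ NatBtw (D.pos a) (D.pos d) (D.pos (f x.t)) ∧
        ((NatBtw (D.pos a) (D.pos b) (D.pos (f x.t)) ∧ (F x).s = a ∧ (F x).e = b) ∨
        (¬ NatBtw (D.pos a) (D.pos b) (D.pos (f x.t)) ∧
          NatBtw (D.pos c) (D.pos d) (D.pos (f x.t)) ∧
          (D.pos a < D.pos (f x.t) ↔ D.pos c < D.pos (f x.t)) ∧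
          (F x).s = c ∧ (F x).e = d)))) := by
    intro x
    by_cases h : f x.s = a
    · have hp := hpos x
      have ht := (hterm _).1 x.ter
      have htu := terminal_not_base ht
      rw [h, ((hover' x).resolve_right fun h' => h'.1 h).2] at hp
      by_cases h' : D.Btw a b (f x.t)
      · have hFx : F x = ⟨a, b, f x.t, T.ab, (hterm _).1 x.ter, h'⟩ := by
          simp only [F, dif_pos h, dif_pos h']
        rw [hFx]
        exact ⟨rfl, .inr ⟨h, hp, .inl ⟨(btw_iff (over_left T.ab) T.b_up htu).1 h', rfl, rfl⟩⟩⟩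
      · have hFx : (F x).s = c ∧ (F x).e = d ∧ (F x).t = f x.t := by
          simp only [F, dif_pos h, dif_neg h', and_self]
        rw [btw_iff (over_left T.ab) T.b_up htu] at h'
        have hj := join_cases hp h' (T.not_btw htu) (T.pos_ne_b ht) (T.pos_ne_c ht)
        exact ⟨hFx.2.2, .inr ⟨h, hp, .inr ⟨h', hj.1, hj.2, hFx.1, hFx.2.1⟩⟩⟩
    · have hFx : (F x).s = f x.s ∧ (F x).e = f x.e ∧ (F x).t = f x.t := by
        simp only [F, dif_neg h, and_self]
      exact ⟨hFx.2.2, .inl ⟨h, hFx.1, hFx.2.1⟩⟩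
  obtain ⟨g, hg⟩ := exists_emb (A := D.crossings) (B := E.crossings) F
    (fun x => by
      show crv (F x).t = crv x.t
      rw [(hF x).1, hcrv])
    (fun x => by
      show crv (F x).s = crv x.s
      rcases (hF x).2 with ⟨-, h, -⟩ | ⟨h', -, ⟨-, h, -⟩ | ⟨-, -, -, h, -⟩⟩ <;> rw [h]
      · exact hcrv _
      · rw [← h', hcrv]
      · rw [← hi.2.1, ← hi.1, ← h', hcrv])
    (fun x => by
      show D.ltP (F x).s (F x).t ↔ E.ltP x.s x.t
      rw [← hP, ltP_iff (F x).s_up (F x).t_up, ltP_iff (hup _ x.s_up) (hup _ x.t_up), (hF x).1]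
      rcases (hF x).2 with ⟨-, h, -⟩ | ⟨h', -, ⟨-, h, -⟩ | ⟨-, -, h1, h, -⟩⟩ <;> rw [h]
      · rw [h']
      · rw [h', h1])
    (fun x y (h : x.Before y) => by
      show (F x).Before (F y)
      rw [Crossing.before_iff]
      rcases h with h | ⟨h, h'⟩
      · left
        rw [← hdel.ltC] at h
        have hcase : ∀ z : E.Crossing, (F z).s = f z.s ∨ (f z.s = a ∧ (F z).s = c) := by
          intro z
          rcases (hF z).2 with ⟨-, h, -⟩ | ⟨h', -, ⟨-, h, -⟩ | ⟨-, -, -, h, -⟩⟩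
          · exact .inl h
          · exact .inl (h.trans h'.symm)
          · exact .inr ⟨h', h⟩
        have hac : ∀ z, f z = a → D.ltC (f z) c := fun z hz => by
          rw [hz, ltC_iff]
          exact ⟨hi.1.trans hi.2.1, by omega⟩
        rcases hcase y with hy | ⟨hy, hy'⟩
        · rw [hy]
          rcases hcase x with hx | ⟨hx, hx'⟩
          · rw [hx]; exact h
          · rw [hx']
            rw [hx, ltC_iff] at h
            rw [ltC_iff]
            have n1 := mt (eq_of_idx (h.1.symm.trans hi.1)) (hne y.s).1
            have n2 := mt (eq_of_idx (h.1.symm.trans (hi.1.trans hi.2.1))) (hne y.s).2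
            exact ⟨by rw [← h.1, hi.1, hi.2.1], by omega⟩
        · rw [hy']
          rcases hcase x with hx | ⟨hx, -⟩
          · rw [hx]
            exact D.ltC_trans _ _ _ h (hac _ hy)
          · rw [hx, hy] at h
            exact absurd h (D.ltC_irrefl _)
      · rw [← hP, ← hP, ← hP, ← hP, ltP_iff (hup _ x.s_up) (hup _ x.t_up),
          ltP_iff (hup _ x.t_up) (hup _ y.t_up), ltP_iff (hup _ x.t_up) (hup _ x.s_up),
          ltP_iff (hup _ y.t_up) (hup _ x.t_up)] at h'
        rw [(hF x).1, (hF y).1]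
        rcases (hF x).2 with ⟨hxa, hx, -⟩ | ⟨hxa, hx1, ⟨hx2, hx, -⟩ | ⟨hx2, hx3, hx4, hx, -⟩⟩ <;>
        rcases (hF y).2 with ⟨hya, hy, -⟩ | ⟨hya, hy1, ⟨hy2, hy, -⟩ | ⟨hy2, hy3, hy4, hy, -⟩⟩
        · rw [hx, hy]; exact .inr ⟨congrArg f h, h'⟩
        · exact absurd (h ▸ hya) hxa
        · exact absurd (h ▸ hya) hxa
        · exact absurd (h ▸ hxa) hya
        · rw [hx, hy]; rw [hxa] at h'; exact .inr ⟨rfl, h'⟩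
        · left
          rw [hx, hy, ltC_iff]
          exact ⟨hi.1.trans hi.2.1, by omega⟩
        · exact absurd (h ▸ hxa) hya
        · rw [hxa] at h'
          exact absurd h' (join_order hy2 hx2)
        · right
          rw [hx, hy]
          rw [hxa] at h'
          have h1 := T.pos_ne_a ((hterm _).1 x.ter)
          have h2 := T.pos_ne_c ((hterm _).1 x.ter)
          exact ⟨rfl, by omega⟩)
    (fun x y (h : x.Inside y) => by
      show (F x).Inside (F y)
      have hxp := hpos x
      have htt : f x.t = f y.t := congrArg f h.1
      have hxt := (hterm _).1 x.ter
      have hin : NatBtw (D.pos (f y.s)) (D.pos (f y.e)) (D.pos (f x.s)) :=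
        (btw_iff (hup _ y.s_up) (hup _ y.e_up) (hup _ x.s_up)).1 ((btw_map hP).2 h.2)
      have hn := fun z (hz : z ∉ E.base) => T.not_btw (hup z hz)
      have hnb := fun z (hz : z ∉ E.base) => pos_ne T.b_up (hup z hz) (hne z).1.symm
      have hnc := fun z (hz : z ∉ E.base) => pos_ne T.c_up (hup z hz) (hne z).2.symm
      rw [Crossing.inside_iff, (hF x).1, (hF y).1]
      refine ⟨htt, ?_⟩
      show NatBtw _ _ _
      rcases (hF y).2 with ⟨hya, hy, hye⟩ | ⟨hya, hy1, hy2⟩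
      · rw [hy, hye]
        have harc := ((hover' y).resolve_left fun h' => hya h'.1).2
        have hab := over_pair harc T.ab
        rcases hab with ⟨-, e⟩ | hab
        · exact absurd e (hne y.e).1
        rcases (hF x).2 with ⟨hxa, hx, -⟩ | ⟨hxa, hx1, ⟨hx2, hx, -⟩ | ⟨hx2, hx3, hx4, hx, -⟩⟩
        · rw [hx]; exact hin
        · rw [hx, ← hxa]; exact hin
        · rw [hx]
          rw [hxa] at hin
          exact join_inside hin (hn _ y.s_up) (hn _ y.e_up) (hnb _ y.s_up) (hnb _ y.e_up)
            (hnc _ y.s_up) (hnc _ y.e_up) hab.2.2.2.2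
      · have hyd := ((hover' y).resolve_right fun h' => h'.1 hya).2
        have hxa : f x.s ≠ a := by
          intro hxa
          rw [hya, hxa] at hin
          omega
        have harc := ((hover' x).resolve_left fun h' => hxa h'.1).2
        obtain ⟨-, hx, -⟩ := (hF x).2.resolve_right fun h' => hxa h'.1
        rw [hya, hyd] at hin
        rw [htt] at hxp hxt
        rcases over_pair T.ab harc with ⟨e, -⟩ | hab
        · exact absurd e.symm hxa
        rcases over_pair T.cd harc with ⟨e, -⟩ | hcd
        · exact absurd e.symm (hne x.s).2
        rw [hx]
        rcases hy2 with ⟨hy2, hys, hye⟩ | ⟨hy2, hy3, hy4, hys, hye⟩ <;> rw [hys, hye]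
        · exact inside_join_first hin hy1 hy2 hxp (T.not_btw (terminal_not_base hxt))
            (hn _ x.s_up) (hnb _ x.s_up) (hnc _ x.s_up) (T.pos_ne_c hxt)
            hab.2.2.2.2 hcd.2.2.2.2
        · exact inside_join_second hin hy2 hxp (hn _ x.s_up) (hnb _ x.s_up) (hnc _ x.s_up)
            hab.2.2.2.2)
  obtain ⟨M, hM⟩ := (Set.finite_range fun t => D.dist b t).bddAbove
  have hM' : ∀ t, D.dist b t < M + 1 := fun t => Nat.lt_succ_of_le (hM ⟨t, rfl⟩)
  -- Beyond the bound `M` on all distances every shared crossing is gone. What is left are the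
  -- crossings of the untouched arcs and those of the joined arc.
  refine (T.eqv_keep (M + 1)).trans (iso_of_emb (D.crossings.incl _) g ?_).eqv
  rw [range_incl, hg]
  refine Set.ext fun (w : D.Crossing) => ?_
  refine (mem_keep (w := w)).trans ?_
  have hac : a ≠ c := by rintro rfl; omega
  constructor
  · intro hw
    have hw : ¬ ((w.s = a ∨ w.s = c) ∧ D.Shared a b c d w.t) := fun h => hw ⟨h.1, h.2, hM' _⟩
    have hwt := w.ter
    have hwb := T.pos_ne_b w.ter
    have hwc := T.pos_ne_c w.ter
    obtain ⟨t, ht⟩ := hdel.exists_eq (y := w.t) (by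
      rintro (h | h)
      · exact hwb (congrArg _ h)
      · exact hwc (congrArg _ h))
    have htE : E.IsTerminal t := (hterm t).2 (ht ▸ w.ter)
    have hwn := T.not_btw w.t_up
    have pw : NatBtw _ _ _ := w.btw_pos
    have iw := isOverArc_iff.1 w.arc
    obtain ⟨a', ha'⟩ := hdel.exists_eq (y := a) (by
      rintro (rfl | rfl) <;> omega)
    obtain ⟨d', hd'⟩ := hdel.exists_eq (y := d) (by
      rintro (rfl | rfl) <;> omega)
    have harc' : IsOverArc E.ltC a' d' := (hover _ _).2 (.inr ⟨ha', hd'⟩)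
    have hjoin : NatBtw (D.pos a) (D.pos d) (D.pos w.t) →
        ∃ x : E.Crossing, f x.s = a ∧ f x.t = w.t := fun h =>
      ⟨⟨a', d', t, harc', htE, by
        rw [← btw_map hP, ha', hd', ht]
        exact (btw_iff (over_left T.ab) (over_right T.cd) w.t_up).2 h⟩, ha', ht⟩
    by_cases hwa : w.s = a
    · have e : w.e = b := eq_of_idx (by rw [← iw.1, hwa, hi.1]) (by rw [hwa] at iw; omega)
      rw [hwa, e] at pw
      have hns : ¬ (NatBtw (D.pos c) (D.pos d) (D.pos w.t) ∨ w.t = d) := fun h =>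
        hw ⟨.inl hwa, pw, h⟩
      rw [not_or] at hns
      obtain ⟨x, hxs, hxt⟩ := hjoin (join_first pw hns.1 hwn hwb hwc
        (pos_ne w.t_up (over_right T.cd) hns.2))
      refine ⟨x, Crossing.ext' ?_ ((hF x).1.trans hxt)⟩
      rcases (hF x).2 with ⟨h, -⟩ | ⟨-, -, ⟨-, h, -⟩ | ⟨h, -⟩⟩
      · exact absurd hxs h
      · rw [h, hwa]
      · rw [hxt] at h; exact absurd pw h
    · by_cases hwc' : w.s = c
      · have e : w.e = d := eq_of_idx (by rw [← iw.1, hwc', hi.2.2.1]) (by rw [hwc'] at iw; omega)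
        rw [hwc', e] at pw
        have hns : ¬ NatBtw (D.pos a) (D.pos b) (D.pos w.t) := fun h =>
          hw ⟨.inr hwc', h, .inl pw⟩
        obtain ⟨x, hxs, hxt⟩ := hjoin (join_second pw hns hwn hwb hwc (T.pos_ne_a w.ter))
        refine ⟨x, Crossing.ext' ?_ ((hF x).1.trans hxt)⟩
        rcases (hF x).2 with ⟨h, -⟩ | ⟨-, -, ⟨h, -⟩ | ⟨-, -, -, h, -⟩⟩
        · exact absurd hxs h
        · rw [hxt] at h; exact absurd h hns
        · rw [h, hwc']
      · obtain ⟨s, hs⟩ := hdel.exists_eq (y := w.s) (by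
          rintro (h | h)
          · rw [h] at iw; omega
          · exact hwc' h)
        obtain ⟨e, he⟩ := hdel.exists_eq (y := w.e) (by
          rintro (h | h)
          · rw [h] at iw
            exact hwa (eq_of_idx (by rw [iw.1, hi.1]) (by omega))
          · rw [h] at iw; omega)
        have harc := w.arc
        have hbtw := w.btw
        rw [← hs, ← he] at harc
        rw [← hs, ← he, ← ht, btw_map hP] at hbtw
        let x : E.Crossing := ⟨s, e, t, (hover _ _).2 (.inl harc), htE, hbtw⟩
        refine ⟨x, Crossing.ext' ?_ ((hF x).1.trans ht)⟩
        rcases (hF x).2 with ⟨-, h, -⟩ | ⟨h, -⟩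
        · rw [h]; exact hs
        · exact absurd (hs.symm.trans h) hwa
  · rintro ⟨x, rfl⟩ ⟨h1, ⟨h2, h3⟩, -⟩
    rw [(hF x).1] at h2 h3
    have ht := (hterm _).1 x.ter
    rcases (hF x).2 with ⟨hxa, hx, -⟩ | ⟨hxa, hx1, ⟨hx2, hx, -⟩ | ⟨hx2, hx3, hx4, hx, -⟩⟩
    · rw [hx] at h1
      exact h1.elim hxa (hne x.s).2
    · rcases h3 with h3 | h3
      · exact join_not_shared hx1 hx2 (T.not_btw (terminal_not_base ht)) (T.pos_ne_c ht) h3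
      · rw [h3] at hx1
        omega
    · exact hx2 h2

theorem BMove.eqv (h : D.BMove E) : D.crossings.Eqv E.crossings := by
  obtain ⟨a, b, c, d, hab, hbc, hcd, hadj, f, hinj, hr, hP, hC⟩ := h
  have hdel : D.Deletion {b, c} E.ltC f := ⟨hinj, hr, hC⟩
  have hab' := isArc_iff.1 hab
  have hbc' := isArc_iff.1 hbc
  have hcd' := isArc_iff.1 hcd
  have hup : ∀ x, x ∉ E.base → f x ∉ D.base := by
    intro x hx
    rw [base_iff_idx] at hx ⊢
    have h1 : E.idx x = curveIndex E.ltC x := rfl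
    rcases hdel.B_idx hbc x with h | ⟨h, -⟩ <;> omega
  obtain ⟨d, rfl⟩ : ∃ d', f d' = d := hdel.exists_eq (by rintro (rfl | rfl) <;> omega)
  have hterm : ∀ x, E.IsTerminal x ↔ D.IsTerminal (f x) := by
    intro x
    constructor
    · intro hx y hy
      by_cases hyb : y ∈ ({b, c} : Set D.P)
      · refine hx d ((hC _ _).1 ?_)
        rcases hyb with rfl | rfl
        · exact D.ltC_trans _ _ _ hy (D.ltC_trans _ _ _ hbc.1 hcd.1)
        · exact D.ltC_trans _ _ _ hy hcd.1
      · obtain ⟨y, rfl⟩ := hdel.exists_eq hyb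
        exact hx y ((hC _ _).1 hy)
    · intro hx y hy
      exact hx _ ((hC _ _).2 hy)
  have hcrv : ∀ x, crv (f x) = crv x :=
    crv_unique (fun x => crv (f x)) (fun x y h => (ltC_iff.1 ((hC x y).2 h)).1)
      fun s t hs ht h => crv_lt ((hterm s).1 hs) ((hterm t).1 ht) ((hP s t).2 h)
  rcases Nat.mod_two_eq_zero_or_one (D.idx a) with ho | ho
  -- Here `(b, c)` is itself an over arc. Its endpoints are adjacent, so it crosses nothing and no
  -- crossing is lost.
  · refine (iso_of_map f hP hC hterm (fun x y => ?_) fun w => ?_).eqv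
    · rw [hdel.B_over hab hbc hcd, ho]
      simp
    · have iw := isOverArc_iff.1 w.arc
      have hbup : b ∉ D.base := not_base_of_idx (by omega)
      have hcup : c ∉ D.base := not_base_of_idx (by omega)
      have hsb : w.s ≠ b := by
        intro h
        have e : w.e = c := eq_of_idx (by rw [← iw.1, h, hbc'.1]) (by rw [h] at iw; omega)
        have := adjacent_pos hbup hcup hadj w.t_up
        have pw := w.btw_pos
        rw [h, e] at pw
        omega
      obtain ⟨s, hs⟩ := hdel.exists_eq (y := w.s) (by
        rintro (h | h)
        · exact hsb h
        · rw [h] at iw; omega)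
      obtain ⟨e, he⟩ := hdel.exists_eq (y := w.e) (by
        rintro (h | h)
        · rw [h] at iw; omega
        · rw [h] at iw
          exact hsb (eq_of_idx (by rw [iw.1, hbc'.1]) (by omega)))
      obtain ⟨t, ht⟩ := hdel.exists_eq (y := w.t) (by
        rintro (h | h)
        · exact w.ter _ (h ▸ hbc.1)
        · exact w.ter _ (h ▸ hcd.1))
      exact ⟨s, e, t, hs, he, ht⟩
  · refine Turn.eqv_of_deletion (a := a) (b := b) (c := c) (d := f d) ⟨?_, hbc, ?_, hadj⟩ hdel hP hup
      hterm hcrv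
    · exact isOverArc_iff.2 ⟨hab'.1, hab'.2, ho⟩
    · exact isOverArc_iff.2 ⟨hcd'.1, hcd'.2, by omega⟩

/-- Equivalent diagrams have equivalent crossing systems. -/
theorem Equivalent.eqv (h : D.Equivalent E) : D.crossings.Eqv E.crossings := by
  induction h with
  | rel _ _ h =>
    rcases h with h | h | h
    · exact h.eqv
    · exact h.eqv
    · exact h.eqv
  | refl => exact (Iso.refl _).eqv
  | symm _ _ _ ih => exact ih.symm
  | trans _ _ _ _ _ ih ih' => exact ih.trans ih'

/-- Simplified representatives: the crossing system of `π · D` is that of `D`, with the marked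
points permuted. -/
theorem Represents.iso {π : Equiv.Perm (Fin n)} (h : E.Represents π D) (hD : D.Simplified)
    (hE : E.Simplified) : Iso (D.crossings.relabel π) E.crossings := by
  obtain ⟨D', E', h1, h2, h3⟩ := h
  refine Normal.iso (fun S hS => hD.normal S ?_) hE.normal
    ((Eqv.relabel π h1.eqv).trans (h2.iso.eqv.trans h3.eqv))
  -- Renaming by the injective `π` creates no removals.
  rcases hS with ⟨x, y, h, rfl⟩ | ⟨x, h, rfl⟩
  · exact .inl ⟨x, y, ⟨π.injective h.col, π.injective h.lev, h.up, h.cur, h.stk⟩, rfl⟩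
  · exact .inr ⟨x, ⟨π.injective h.col, h.cur, h.stk⟩, rfl⟩

end VCD

/-! ### Traces of terminal over arcs, and their compatibility -/

namespace CrossingSystem

variable {n : ℕ} {A B : CrossingSystem n}

/-- What a terminal over arc of type `(k, l)`, `l = k + 1`, contributes to the crossing system. -/
def UpEnd (A : CrossingSystem n) (k l : Fin n) : Prop :=
  ∃ e, A.lev e = k ∧ A.col e = l ∧ A.up e ∧ (∀ y, ¬ A.cur e y) ∧
    (∀ x, A.lev x = l → A.up x → ∃ y, A.cur y x ∧ A.lev y = k ∧ A.up y) ∧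
    (∀ x, A.lev x = l → ¬ A.up x → ∃ y, A.cur x y) ∧
    (∀ x, A.stk e x → A.up x → ∃ y, A.cur x y)

/-- What a terminal over arc of type `(k, l)`, `k = l + 1`, contributes to the crossing system. -/
def DownEnd (A : CrossingSystem n) (k l : Fin n) : Prop :=
  ∃ e, A.lev e = k ∧ A.col e = l ∧ ¬ A.up e ∧ (∀ y, ¬ A.cur e y) ∧
    (∀ x, A.lev x = l → A.up x → ∃ y, A.cur x y)

theorem UpEnd.of_iso {k l : Fin n} (h : B.UpEnd k l) (hAB : Iso B A) : A.UpEnd k l := by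
  obtain ⟨f, hf⟩ := hAB
  simp only [UpEnd, hf.forall, hf.exists, f.lev, f.col, f.up, f.cur, f.stk] at h ⊢
  exact h

theorem DownEnd.of_iso {k l : Fin n} (h : B.DownEnd k l) (hAB : Iso B A) : A.DownEnd k l := by
  obtain ⟨f, hf⟩ := hAB
  simp only [DownEnd, hf.forall, hf.exists, f.lev, f.col, f.up, f.cur] at h ⊢
  exact h

theorem UpEnd.of_relabel {π : Equiv.Perm (Fin n)} {k l : Fin n} (h : (A.relabel π).UpEnd k l) :
    A.UpEnd (π⁻¹ k) (π⁻¹ l) := by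
  simp only [UpEnd, Equiv.Perm.eq_inv_iff_eq]
  exact h

theorem DownEnd.of_relabel {π : Equiv.Perm (Fin n)} {k l : Fin n}
    (h : (A.relabel π).DownEnd k l) : A.DownEnd (π⁻¹ k) (π⁻¹ l) := by
  simp only [DownEnd, Equiv.Perm.eq_inv_iff_eq]
  exact h

theorem last_unique {x y : A.X} (h : A.col x = A.col y) (hx : ∀ z, ¬ A.cur x z)
    (hy : ∀ z, ¬ A.cur y z) : x = y := by
  rcases (A.cur_chains x y).2 h with h | h | h
  · exact h
  · exact absurd h (hx y)
  · exact absurd h (hy x)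

/-- Infinite descent along a curve: every upward crossing over one of the two marked points is
preceded by an upward crossing over the other. -/
theorem UpEnd.not_swapped {i i' : Fin n} (h : A.UpEnd i i') (h' : A.UpEnd i' i) : False := by
  obtain ⟨e, he, -, hup, -, h1, -⟩ := h
  obtain ⟨-, -, -, -, -, h2, -⟩ := h'
  have key : ∀ m x, A.cr x = m → A.up x → A.lev x = i ∨ A.lev x = i' → False := by
    intro m
    induction m using Nat.strong_induction_on with
    | _ m ih =>
      rintro x rfl hx (hl | hl)
      · obtain ⟨y, hy, hl', hy'⟩ := h2 x hl hx
        exact ih _ (cur_iff.1 hy).2 y rfl hy' (.inr hl')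
      · obtain ⟨y, hy, hl', hy'⟩ := h1 x hl hx
        exact ih _ (cur_iff.1 hy).2 y rfl hy' (.inl hl')
  exact key _ e rfl hup (.inl he)

/-- Each forbidden configuration contradicts the last crossings. Reversed pairs are excluded by
descent, or because one last crossing would have two directions. With a common first entry, two
upward last crossings would sit in one stack, where the outer one must be continued; for a `DownEnd`
the crossing `e` itself must be. With a common second entry, either the last crossings coincide, or
a downward last crossing over `i'` must be continued. -/
theorem UpEnd.compatible {i i' p q : Fin n} (h : A.UpEnd i i')
    (h' : A.UpEnd p q ∨ A.DownEnd q p) :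
    ¬ (p = i' ∧ q = i) ∧ (p = i → q = i') ∧ (q = i' → p = i) := by
  refine ⟨?_, ?_, ?_⟩
  · rintro ⟨rfl, rfl⟩
    rcases h' with h' | ⟨f, -, hfc, hfu, hfl, -⟩
    · exact h.not_swapped h'
    · obtain ⟨e, -, hec, heu, hel, -⟩ := h
      have := last_unique (hec.trans hfc.symm) hel hfl
      exact hfu (this ▸ heu)
  · rintro rfl
    by_contra hq
    obtain ⟨e, hel, hec, heu, hlast, -, -, h3⟩ := h
    rcases h' with ⟨f, hfl, hfc, hfu, hflast, -, -, h3'⟩ | ⟨-, -, -, -, -, h4⟩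
    · rcases (A.stk_chains e f).2 (hel.trans hfl.symm) with hs | hs | hs
      · exact hq (by rw [← hfc, ← hec, hs])
      · obtain ⟨y, hy⟩ := h3 f hs hfu
        exact hflast y hy
      · obtain ⟨y, hy⟩ := h3' e hs heu
        exact hlast y hy
    · obtain ⟨y, hy⟩ := h4 e hel heu
      exact hlast y hy
  · rintro rfl
    obtain ⟨e, hel, hec, heu, hlast, -, h2, -⟩ := h
    rcases h' with ⟨f, hfl, hfc, hfu, hflast, -⟩ | ⟨f, hfl, hfc, hfu, hflast, -⟩
    · rw [← hfl, ← last_unique (hec.trans hfc.symm) hlast hflast, hel]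
    · obtain ⟨y, hy⟩ := h2 f hfl hfu
      exact absurd hy (hflast y)

end CrossingSystem

namespace VCD

variable {n : ℕ} {D : VCD n}

/-- After the crossing of a terminal over arc closest to its end there is none. -/
theorem last_of_terminal (x z : D.Crossing) (he : D.IsTerminal x.e)
    (h : (crv x.t : ℕ) + 1 = crv x.e ∨ (crv x.e : ℕ) + 1 = crv x.t) : ¬ x.Before z := by
  rw [Crossing.before_iff, ltC_iff]
  have ix := isOverArc_iff.1 x.arc
  have iz := isOverArc_iff.1 z.arc
  rintro (h1 | ⟨h1, h2⟩)
  · have := terminal_idx he (x := z.s) (by rw [← h1.1, ix.1])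
    omega
  · have e := Crossing.e_eq h1
    have pz := z.btw_pos
    rw [← e, ← h1] at pz
    have h3 := crv_lt_iff x.ter z.ter
    have h4 := crv_lt_iff z.ter he
    have h5 := crv_lt_iff z.ter x.ter
    have h6 := crv_lt_iff he z.ter
    rw [Fin.lt_def] at h3 h4 h5 h6
    omega

/-- Over arcs do not cross `(a, b)`, so any arc that encloses `b`, or lies outside `(a, b)` over
`c`, encloses both `a` and `b`. It therefore crosses both `c` and `b`, in the order given by its
direction. As `c` is the terminal point just before `b`, the crossing of `(a, b)` over `c` is the
last one of its curve. -/
theorem HasTerminalOverArc.upEnd {k l : Fin n} (h : D.HasTerminalOverArc k l)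
    (hkl : (k : ℕ) + 1 = l) : D.crossings.UpEnd k l := by
  obtain ⟨a, b, c, harc, hb, hc, -, henc⟩ := h
  rw [isTerminalAt_iff] at hb hc
  obtain ⟨hb, rfl⟩ := hb
  obtain ⟨hc, rfl⟩ := hc
  have hcu := terminal_not_base hc
  have hbu := terminal_not_base hb
  have hbtw : D.Btw a b c := henc
  have hpos := (btw_iff (over_left harc) hbu hcu).1 hbtw
  have hcb := (crv_lt_iff hc hb).1 (by rw [Fin.lt_def]; omega)
  have key : ∀ x : D.Crossing, x.t = b ∨ ((⟨a, b, c, harc, hc, hbtw⟩ : D.Crossing).Inside x) →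
      (D.pos x.s < D.pos a ∧ D.pos b < D.pos x.e) ∨
        (D.pos x.e < D.pos a ∧ D.pos b < D.pos x.s) := by
    intro x hx
    have px := x.btw_pos
    rw [Crossing.inside_iff] at hx
    rcases over_pair x.arc harc with ⟨h1, h2⟩ | h1
    · rw [h1, h2] at hx px
      rcases hx with hx | ⟨-, hx⟩
      · rw [hx] at px; omega
      · simp only at hx; omega
    · obtain ⟨-, -, -, -, h1⟩ := h1
      rcases hx with hx | ⟨-, hx⟩
      · rw [hx] at px
        have := h1.2 px
        omega
      · have := h1.1 hx
        simp only at hx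
        omega
  refine ⟨(⟨a, b, c, harc, hc, hbtw⟩ : D.Crossing), rfl, (isOverArc_iff.1 harc).1, ?_,
    fun (y : D.Crossing) => last_of_terminal _ y hb (.inl hkl), fun (x : D.Crossing) hx hxu => ?_,
    fun (x : D.Crossing) hx hxu => ?_, fun (x : D.Crossing) hx hxu => ?_⟩
  · show D.ltP a c
    rw [ltP_iff (over_left harc) hcu]
    omega
  · have hxt : x.t = b := terminal_ext x.ter hb hx
    have h1 := key x (.inl hxt)
    replace hxu : D.ltP x.s x.t := hxu
    rw [hxt, ltP_iff x.s_up hbu] at hxu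
    let y : D.Crossing := ⟨x.s, x.e, c, x.arc, hc, (btw_iff x.s_up x.e_up hcu).2 (by omega)⟩
    refine ⟨y, ?_, rfl, ?_⟩
    · show y.Before x
      rw [Crossing.before_iff, hxt]
      exact .inr ⟨rfl, .inl ⟨by show D.pos x.s < D.pos c; omega, hcb⟩⟩
    · show D.ltP x.s c
      rw [ltP_iff x.s_up hcu]
      omega
  · have hxt : x.t = b := terminal_ext x.ter hb hx
    have h1 := key x (.inl hxt)
    replace hxu : ¬ D.ltP x.s x.t := hxu
    rw [hxt, ltP_iff x.s_up hbu] at hxu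
    let y : D.Crossing := ⟨x.s, x.e, c, x.arc, hc, (btw_iff x.s_up x.e_up hcu).2 (by omega)⟩
    refine ⟨y, ?_⟩
    show x.Before y
    rw [Crossing.before_iff, hxt]
    exact .inr ⟨rfl, .inr ⟨by omega, hcb⟩⟩
  · have h1 := key x (.inr hx)
    have hxt : c = x.t := hx.1
    replace hxu : D.ltP x.s x.t := hxu
    rw [← hxt, ltP_iff x.s_up hcu] at hxu
    let y : D.Crossing := ⟨x.s, x.e, b, x.arc, hb, (btw_iff x.s_up x.e_up hbu).2 (by omega)⟩
    refine ⟨y, ?_⟩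
    show x.Before y
    rw [Crossing.before_iff, ← hxt]
    exact .inr ⟨rfl, .inl ⟨hxu, hcb⟩⟩

/-- Now `b` is left of `c` and `c` left of `a`. An arc that passes over `b` to the right must reach
beyond `a`, so it crosses `c` afterwards. -/
theorem HasTerminalOverArc.downEnd {k l : Fin n} (h : D.HasTerminalOverArc k l)
    (hkl : (l : ℕ) + 1 = k) : D.crossings.DownEnd k l := by
  obtain ⟨a, b, c, harc, hb, hc, -, henc⟩ := h
  rw [isTerminalAt_iff] at hb hc
  obtain ⟨hb, rfl⟩ := hb
  obtain ⟨hc, rfl⟩ := hc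
  have hcu := terminal_not_base hc
  have hbu := terminal_not_base hb
  have hbtw : D.Btw a b c := henc
  have hpos := (btw_iff (over_left harc) hbu hcu).1 hbtw
  have hcb := (crv_lt_iff hb hc).1 (by rw [Fin.lt_def]; omega)
  refine ⟨(⟨a, b, c, harc, hc, hbtw⟩ : D.Crossing), rfl, (isOverArc_iff.1 harc).1, ?_,
    fun (y : D.Crossing) => last_of_terminal _ y hb (.inr hkl), fun (x : D.Crossing) hx hxu => ?_⟩
  · show ¬ D.ltP a c
    rw [ltP_iff (over_left harc) hcu]
    omega
  · have hxt : x.t = b := terminal_ext x.ter hb hx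
    have px := x.btw_pos
    replace hxu : D.ltP x.s x.t := hxu
    rw [hxt, ltP_iff x.s_up hbu] at hxu
    rw [hxt] at px
    have h1 : D.pos a < D.pos x.e := by
      rcases over_pair x.arc harc with ⟨h1, h2⟩ | h1
      · rw [h1, h2] at px
        omega
      · have := h1.2.2.2.2.2 px
        omega
    let y : D.Crossing := ⟨x.s, x.e, c, x.arc, hc, (btw_iff x.s_up x.e_up hcu).2 (by omega)⟩
    refine ⟨y, ?_⟩
    show x.Before y
    rw [Crossing.before_iff, hxt]
    exact .inr ⟨rfl, .inl ⟨hxu, hcb⟩⟩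

end VCD

/-! ### The permutation and the conclusion -/

/-- Distinct elements of `Fin n` can be moved to the initial places. -/
theorem exists_perm_initial {n m : ℕ} (v : Fin m → Fin n) (hv : Function.Injective v) :
    ∃ γ : Equiv.Perm (Fin n), ∀ k, (γ (v k) : ℕ) = k := by
  have hmn : m ≤ n := by simpa using Fintype.card_le_of_injective v hv
  have := Equiv.Perm.isMultiplyPretransitive (Fin n) m
  obtain ⟨γ, hγ⟩ := MulAction.exists_smul_eq (Equiv.Perm (Fin n)) (⟨v, hv⟩ : Fin m ↪ Fin n)
    (Fin.castLEEmb hmn)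
  refine ⟨γ, fun k => ?_⟩
  have := DFunLike.congr_fun hγ k
  exact congrArg Fin.val this

/-- Two compatible ordered pairs can be made consecutive at the same time. -/
theorem exists_perm_consecutive {n : ℕ} {i i' p q : Fin n} (hi : i ≠ i') (hp : p ≠ q)
    (h1 : ¬ (p = i' ∧ q = i)) (h2 : p = i → q = i') (h3 : q = i' → p = i) :
    ∃ γ : Equiv.Perm (Fin n), (γ i' : ℕ) = γ i + 1 ∧ (γ q : ℕ) = γ p + 1 := by
  -- The two pairs coincide, or form a chain through `i'` or through `i`, or are disjoint. Each time
  -- the entries are listed in order and moved to the front.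
  by_cases hpi : p = i
  · obtain rfl := h2 hpi
    subst hpi
    obtain ⟨γ, hγ⟩ := exists_perm_initial ![p, q] (by
      intro x y; fin_cases x <;> fin_cases y <;> simp [hi, hi.symm])
    have e0 := hγ 0
    have e1 := hγ 1
    simp at e0 e1
    exact ⟨γ, by omega, by omega⟩
  have hqi' : q ≠ i' := fun h => hpi (h3 h)
  by_cases hpi' : p = i'
  · subst hpi'
    have hqi : q ≠ i := fun h => h1 ⟨rfl, h⟩
    obtain ⟨γ, hγ⟩ := exists_perm_initial ![i, p, q] (by
      intro x y; fin_cases x <;> fin_cases y <;> simp [hi, hi.symm, hp, hp.symm, hqi, hqi.symm])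
    have e0 := hγ 0
    have e1 := hγ 1
    have e2 := hγ 2
    simp at e0 e1 e2
    exact ⟨γ, by omega, by omega⟩
  by_cases hqi : q = i
  · subst hqi
    obtain ⟨γ, hγ⟩ := exists_perm_initial ![p, q, i'] (by
      intro x y
      fin_cases x <;> fin_cases y <;> simp [hi, hi.symm, hp, hp.symm, hpi', Ne.symm hpi'])
    have e0 := hγ 0
    have e1 := hγ 1
    have e2 := hγ 2
    simp at e0 e1 e2
    exact ⟨γ, by omega, by omega⟩
  · obtain ⟨γ, hγ⟩ := exists_perm_initial ![i, i', p, q] (by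
      intro x y
      fin_cases x <;> fin_cases y <;> simp [hi, hi.symm, hp, hp.symm, hpi, hpi', hqi, hqi',
        Ne.symm hpi, Ne.symm hpi', Ne.symm hqi, Ne.symm hqi'])
    have e0 := hγ 0
    have e1 := hγ 1
    have e2 := hγ 2
    have e3 := hγ 3
    simp at e0 e1 e2 e3
    exact ⟨γ, by omega, by omega⟩

theorem proposition4p2 (n : ℕ) (D E : VCD n) (π : Equiv.Perm (Fin n))
    (hD : D.Simplified) (hE : E.Simplified) (hπ : E.Represents π D)
    (i j : ℕ) (hi : i + 1 < n) (hj : j + 1 < n)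
    (hDi : D.HasTerminalOverArc ⟨i, Nat.lt_of_succ_lt hi⟩ ⟨i + 1, hi⟩)
    (hEj : E.HasTerminalOverArc ⟨j, Nat.lt_of_succ_lt hj⟩ ⟨j + 1, hj⟩ ∨
      E.HasTerminalOverArc ⟨j + 1, hj⟩ ⟨j, Nat.lt_of_succ_lt hj⟩) :
    ∃ γ : Equiv.Perm (Fin n), Intact γ i hi ∧ Intact (γ * π⁻¹) j hj := by
  have hiso := (hπ.iso hD hE).symm
  -- Type `(j, j+1)` becomes an `UpEnd` for `(p, q)` and type `(j+1, j)` a `DownEnd` for `(q, p)`,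
  -- where `p = π⁻¹ j` and `q = π⁻¹ (j+1)`. Both are traces in the crossing system of `D`.
  have h := (hDi.upEnd rfl).compatible
    (hEj.imp (fun h => ((h.upEnd rfl).of_iso hiso).of_relabel)
      fun h => ((h.downEnd rfl).of_iso hiso).of_relabel)
  refine exists_perm_consecutive (by simp) (fun e => ?_) h.1 h.2.1 h.2.2
  simpa using π⁻¹.injective e
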